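/- Let $n\ge 1$, $\sigma>0$, $\boldsymbol\mu\in\mathbb R^n$, and let $\mathbf y=\boldsymbol\mu+\boldsymbol\xi$ where $\boldsymbol\xi\sim\mathcal N(\mathbf 0,\sigma^2 I_{n\times n})$. Write $\|\boldsymbol u\|=\big(\frac1n\sum_{i=1}^n u_i^2\big)^{1/2}$ for the scaled norm on $\mathbb R^n$. For $m=1,\dots,n$ let $$K_m=\{\boldsymbol u\in\mathbb R^n:\ u_1\ge\dots\ge u_m\le u_{m+1}\le\dots\le u_n\},\qquad \mathcal U=\bigcup_{m=1}^n K_m,$$ so that $\mathcal U$ is the (closed, nonempty) set of unimodal sequences. For $\boldsymbol u\in\mathcal U$ let $k(\boldsymbol u)$ be the smallest integer $k$ such that there is a partition $(T_1,\dots,T_k)$ of $\{1,\dots,n\}$ into sets $T_l$ such that each $T_l$ contains all integers between any two of its elements and $\boldsymbol u$ is constant on each $T_l$. A unimodal least squares estimator is any $\hat{\boldsymbol\mu}\in\operatorname{argmin}_{\boldsymbol u\in\mathcal U}\|\mathbf y-\boldsymbol u\|^2$. Theorem. For all $x>0$, with probability at least $1-e^{-x}$, every unimodal least squares estimator $\hat{\boldsymbol\mu}$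 satisfies $$\|\hat{\boldsymbol\mu}-\boldsymbol\mu\|\ \le\ \inf_{\boldsymbol u\in\mathcal U}\left[\|\boldsymbol u-\boldsymbol\mu\|+\frac{2\sigma}{\sqrt n}\left(\sqrt{(k(\boldsymbol u)+1)\log\Big(\frac{en}{k(\boldsymbol u)+1}\Big)}+\sqrt{2(x+\log n)}\right)\right].$$ -/

import Mathlib

noncomputable section

/-- The scaled norm `‖u‖ = ((1/n) ∑ i, u_i ^ 2)^{1/2}` on `ℝⁿ`. -/
def scaledNorm {n : ℕ} (u : EuclideanSpace ℝ (Fin n)) : ℝ :=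
  √((1 / (n : ℝ)) * ∑ i, u i ^ 2)

/-- The set of least squares estimators over `K` at the observation `y`: all minimizers over
`u ∈ K` of the squared scaled norm of `y - u`. -/
def leastSquares {n : ℕ} (K : Set (EuclideanSpace ℝ (Fin n))) (y : EuclideanSpace ℝ (Fin n)) :
    Set (EuclideanSpace ℝ (Fin n)) :=
  {v | v ∈ K ∧ IsMinOn (fun u => scaledNorm (y - u) ^ 2) K v}

/-- `K_m`: the sequences that are non-increasing up to position `m` and nondecreasing from
position `m` on. -/
def unimodalAt {n : ℕ} (m : Fin n) : Set (EuclideanSpace ℝ (Fin n)) :=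
  {u | AntitoneOn (fun i => u i) (Set.Iic m) ∧ MonotoneOn (fun i => u i) (Set.Ici m)}

/-- The set of all unimodal sequences of length `n`. -/
def unimodal (n : ℕ) : Set (EuclideanSpace ℝ (Fin n)) :=
  ⋃ m : Fin n, unimodalAt m

/-- `u` is piecewise constant with `k` pieces: the index set is partitioned into `k` (nonempty)
sets, each of them convex (it contains all indices between two of its elements), such that `u` is
constant on each of them. -/
def IsPiecewiseConstant {n : ℕ} (u : EuclideanSpace ℝ (Fin n)) (k : ℕ) : Prop :=
  ∃ T : Finpartition (Finset.univ : Finset (Fin n)), T.parts.card = k ∧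
    ∀ A ∈ T.parts, (A : Set (Fin n)).OrdConnected ∧ ∀ a ∈ A, ∀ b ∈ A, u a = u b

/-- `k(u)`: the smallest `k` such that `u` is piecewise constant with `k` pieces. -/
def numPieces {n : ℕ} (u : EuclideanSpace ℝ (Fin n)) : ℕ :=
  sInf {k | IsPiecewiseConstant u k}

/-- The minimum that defines `numPieces` is attained. -/
theorem isPiecewiseConstant_numPieces {n : ℕ} (u : EuclideanSpace ℝ (Fin n)) :
    IsPiecewiseConstant u (numPieces u) := by
  refine Nat.sInf_mem (s := {k | IsPiecewiseConstant u k}) ⟨_, ⊥, rfl, ?_⟩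
  intro A hA
  obtain ⟨a, -, rfl⟩ := (Finpartition.mem_bot_iff).1 hA
  refine ⟨by simpa using Set.ordConnected_singleton, ?_⟩
  intro b hb c hc
  rw [Finset.mem_singleton.1 hb, Finset.mem_singleton.1 hc]

theorem isClosed_unimodal (n : ℕ) : IsClosed (unimodal n) := by
  refine isClosed_iUnion_of_finite fun m => ?_
  have h : unimodalAt m =
      (⋂ (i : Fin n) (_ : i ∈ Set.Iic m) (j : Fin n) (_ : j ∈ Set.Iic m) (_ : i ≤ j),
        {u : EuclideanSpace ℝ (Fin n) | u j ≤ u i}) ∩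
      ⋂ (i : Fin n) (_ : i ∈ Set.Ici m) (j : Fin n) (_ : j ∈ Set.Ici m) (_ : i ≤ j),
        {u : EuclideanSpace ℝ (Fin n) | u i ≤ u j} := by
    ext u
    simp only [unimodalAt, AntitoneOn, MonotoneOn, Set.mem_ofPred_eq, Set.mem_inter_iff,
      Set.mem_iInter]
  rw [h]
  refine IsClosed.inter ?_ ?_ <;>
  · refine isClosed_iInter fun i => isClosed_iInter fun _ => isClosed_iInter fun j =>
      isClosed_iInter fun _ => isClosed_iInter fun _ => isClosed_le ?_ ?_ <;> fun_prop

/-- A least squares estimator over the unimodal sequences exists for every observation. -/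
theorem leastSquares_unimodal_nonempty {n : ℕ} (hn : 1 ≤ n) (y : EuclideanSpace ℝ (Fin n)) :
    (leastSquares (unimodal n) y).Nonempty := by
  have hne : (unimodal n).Nonempty :=
    ⟨0, Set.mem_iUnion.2 ⟨⟨0, hn⟩, fun _ _ _ _ _ => le_rfl, fun _ _ _ _ _ => le_rfl⟩⟩
  obtain ⟨v, hv, hvy⟩ := (isClosed_unimodal n).exists_infDist_eq_dist hne y
  refine ⟨v, hv, fun u hu => ?_⟩
  have h : dist y v ≤ dist y u := hvy ▸ Metric.infDist_le_dist_of_mem hu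
  rw [dist_eq_norm, dist_eq_norm] at h
  have key : ∀ w : EuclideanSpace ℝ (Fin n), scaledNorm w ^ 2 = (1 / (n : ℝ)) * ‖w‖ ^ 2 := by
    intro w
    rw [scaledNorm, Real.sq_sqrt (by positivity), EuclideanSpace.real_norm_sq_eq]
  simp only [Set.mem_ofPred_eq, key]
  gcongr

end

open MeasureTheory Set ProbabilityTheory
open scoped ENNReal Pointwise

/-! Fix a partition `T` of the indices into k intervals and a mode m. If u is constant on the parts
of `T` and the estimator v is unimodal with mode m, then v - u lies in the cone `unimodalCone T m`,
which depends neither on u nor on the noise. Least squares gives ‖v - μ‖ ≤ ‖u - μ‖ + 2q as soon as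
⟨ξ, v - u⟩ ≤ q ‖v - u‖ (`norm_sub_le_of_norm_le`), so it suffices to control the support function of
the cone cut by the unit ball, at a Gaussian point.

Its mean square is at most a sum of contributions of monotone pieces. The parts are intervals, so m
cuts at most one of them and there are at most k + 1 pieces. A piece of length a contributes at most
the harmonic number H_a: a layer-cake integral bounds the conjugate of half the squared norm by
maximal partial sums of the noise minus a level, and Spitzer's identity evaluates their means
(`lintegral_antitoneExcess`). Concavity of the logarithm turns the sum into (k + 1) log(en / (k +
1)) (`sum_harmonic_le`). The support function is 1-Lipschitz, hence exceeds its mean by r with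
probability at most exp(-r²/2); this concentration is derived from the Prékopa–Leindler inequality
(`measure_pi_gaussianReal_lipschitz_ge_le`).

For k = n the concavity step is not available, and the radial density of the Gaussian norm is used
instead (`measure_sqrt_add_lt_norm_le`). A union bound over the n modes costs the log n term. None
is needed over partitions: there are finitely many, so the infimum over u is approached along a
single deterministic one. -/

/-! ### Brunn–Minkowski and Prékopa–Leindler on the line. -/

theorem volume_add_le_of_isCompact {K L C : Set ℝ} (hK : IsCompact K)
    (hL : IsCompact L) (hK' : K.Nonempty) (hL' : L.Nonempty)
    (h : ∀ x ∈ K, ∀ y ∈ L, x + y ∈ C) : volume K + volume L ≤ volume C := by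
  obtain ⟨b, hb, hbK⟩ := hK.exists_isGreatest hK'
  obtain ⟨a, ha, haL⟩ := hL.exists_isLeast hL'
  -- The translates K + min L and max K + L meet only at max K + min L. Removing the null set {max
  -- K} makes them disjoint inside C.
  have h1 : volume ((fun x => x + a) '' (K \ {b})) = volume K := by
    rw [image_add_right, measure_preimage_add_right]
    exact measure_sdiff_null (measure_singleton b)
  have h2 : volume ((fun y => b + y) '' L) = volume L := by simp
  rw [← h1, ← h2, ← measure_union]
  · refine measure_mono (union_subset ?_ ?_)
    · rintro _ ⟨x, hx, rfl⟩
      exact h x hx.1 a ha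
    · rintro _ ⟨y, hy, rfl⟩
      exact h b hb y hy
  · rw [Set.disjoint_left]
    rintro _ ⟨x, hx, rfl⟩ ⟨y, hy, hxy⟩
    have h3 : x < b := lt_of_le_of_ne (hbK hx.1) hx.2
    have h4 : a ≤ y := haL hy
    simp only at hxy
    linarith
  · exact (hL.image (by fun_prop)).measurableSet

/-- The one-dimensional Brunn–Minkowski inequality. -/
theorem volume_add_le {A B C : Set ℝ} (hA : MeasurableSet A) (hB : MeasurableSet B)
    (hA' : A.Nonempty) (hB' : B.Nonempty) (h : ∀ x ∈ A, ∀ y ∈ B, x + y ∈ C) :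
    volume A + volume B ≤ volume C := by
  obtain ⟨a, ha⟩ := hA'
  obtain ⟨b, hb⟩ := hB'
  rw [hA.measure_eq_iSup_isCompact, hB.measure_eq_iSup_isCompact]
  simp only [iSup_and']
  refine ENNReal.biSup_add_biSup_le' ⟨∅, empty_subset _, isCompact_empty⟩
    ⟨∅, empty_subset _, isCompact_empty⟩ ?_
  rintro K ⟨hKA, hK⟩ L ⟨hLB, hL⟩
  -- The approximating compact sets may be empty; adding one point to each repairs this.
  refine le_trans (add_le_add (measure_mono (subset_insert a K))
    (measure_mono (subset_insert b L))) ?_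
  exact volume_add_le_of_isCompact (hK.insert a) (hL.insert b) (insert_nonempty _ _)
    (insert_nonempty _ _) fun x hx y hy =>
      h x (insert_subset ha hKA hx) y (insert_subset hb hLB hy)

theorem volume_convexComb_le {A B C : Set ℝ} {t : ℝ} (ht : 0 < t) (ht' : t < 1)
    (hA : MeasurableSet A) (hB : MeasurableSet B) (hA' : A.Nonempty) (hB' : B.Nonempty)
    (h : ∀ x ∈ A, ∀ y ∈ B, (1 - t) * x + t * y ∈ C) :
    ENNReal.ofReal (1 - t) * volume A + ENNReal.ofReal t * volume B ≤ volume C := by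
  have h1 : 0 < 1 - t := by linarith
  have e : ∀ (s : ℝ) (_ : 0 < s) (S : Set ℝ),
      ENNReal.ofReal s * volume S = volume (s • S) := by
    intro s hs S
    rw [Measure.addHaar_smul]
    simp [abs_of_pos hs]
  rw [e _ h1, e _ ht]
  refine volume_add_le (hA.const_smul₀ _) (hB.const_smul₀ _) hA'.smul_set hB'.smul_set ?_
  rintro _ ⟨x, hx, rfl⟩ _ ⟨y, hy, rfl⟩
  exact h x hx y hy

/-- The Prékopa–Leindler inequality on the line, in the additive form that it takes for functions
with supremum `1`. -/
theorem prekopa_leindler_of_sup_eq_one {f g h : ℝ → ℝ} {t : ℝ} (ht : 0 < t) (ht' : t < 1)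
    (hf : Measurable f) (hg : Measurable g) (hh : Measurable h) (hf0 : ∀ x, 0 ≤ f x)
    (hg0 : ∀ x, 0 ≤ g x) (hh0 : ∀ x, 0 ≤ h x) (hf1 : ∀ x, f x ≤ 1) (hg1 : ∀ x, g x ≤ 1)
    (hfs : ∀ s < 1, ∃ x, s < f x) (hgs : ∀ s < 1, ∃ x, s < g x)
    (H : ∀ x y, f x ^ (1 - t) * g y ^ t ≤ h ((1 - t) * x + t * y)) :
    ENNReal.ofReal (1 - t) * (∫⁻ x, ENNReal.ofReal (f x)) +
      ENNReal.ofReal t * (∫⁻ x, ENNReal.ofReal (g x)) ≤ ∫⁻ x, ENNReal.ofReal (h x) := by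
  have h1 : 0 < 1 - t := by linarith
  rw [lintegral_eq_lintegral_meas_lt _ (.of_forall hf0) hf.aemeasurable,
    lintegral_eq_lintegral_meas_lt _ (.of_forall hg0) hg.aemeasurable,
    lintegral_eq_lintegral_meas_lt _ (.of_forall hh0) hh.aemeasurable]
  have anti : ∀ k : ℝ → ℝ, Measurable fun s => volume {x | s < k x} := fun k =>
    Antitone.measurable fun s s' hs => measure_mono fun x hx => lt_of_le_of_lt hs hx
  rw [← lintegral_const_mul _ (anti f), ← lintegral_const_mul _ (anti g),
    ← lintegral_add_left ((anti f).const_mul _)]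
  refine setLIntegral_mono (anti h) fun s hs => ?_
  -- Both suprema being 1, the superlevel sets of f and g are nonempty at the same levels s < 1,
  -- where Brunn–Minkowski applies.
  rcases lt_or_ge s 1 with hs1 | hs1
  · refine volume_convexComb_le ht ht' (measurableSet_lt measurable_const hf)
      (measurableSet_lt measurable_const hg) (hfs s hs1) (hgs s hs1) ?_
    intro x hx y hy
    refine lt_of_lt_of_le ?_ (H x y)
    have hs0 : (0 : ℝ) < s := hs
    calc s = s ^ (1 - t) * s ^ t := by rw [← Real.rpow_add hs0]; simp
      _ < f x ^ (1 - t) * g y ^ t :=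
        mul_lt_mul'' (Real.rpow_lt_rpow hs0.le hx h1) (Real.rpow_lt_rpow hs0.le hy ht)
          (by positivity) (by positivity)
  · have e1 : {x | s < f x} = ∅ := by
      ext x; simpa using (hf1 x).trans hs1
    have e2 : {x | s < g x} = ∅ := by
      ext x; simpa using (hg1 x).trans hs1
    simp [e1, e2]

theorem ENNReal.rpow_mul_rpow_le_add {t : ℝ} (ht : 0 < t) (ht' : t < 1) (a b : ℝ≥0∞) :
    a ^ (1 - t) * b ^ t ≤ ENNReal.ofReal (1 - t) * a + ENNReal.ofReal t * b := by
  have h1 : 0 < 1 - t := by linarith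
  have := ENNReal.young_inequality (a ^ (1 - t)) (b ^ t)
    (Real.HolderConjugate.one_sub_inv_inv ht ht')
  rw [ENNReal.rpow_rpow_inv h1.ne', ENNReal.rpow_rpow_inv ht.ne', ENNReal.ofReal_inv_of_pos h1,
    ENNReal.ofReal_inv_of_pos ht, div_eq_mul_inv, div_eq_mul_inv, inv_inv, inv_inv] at this
  rwa [mul_comm _ a, mul_comm _ b]

/-- Dividing f and g by their suprema reduces to the additive form, and weighted AM–GM returns to
the product form. Boundedness keeps the suprema finite. -/
theorem prekopa_leindler_of_le {f g h : ℝ → ℝ≥0∞} {t : ℝ} (ht : 0 < t) (ht' : t < 1)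
    (hf : Measurable f) (hg : Measurable g) (hh : Measurable h) {N M : ℝ≥0∞} (hN : N ≠ ∞)
    (hM : M ≠ ∞) (hfN : ∀ x, f x ≤ N) (hgN : ∀ x, g x ≤ M)
    (H : ∀ x y, f x ^ (1 - t) * g y ^ t ≤ h ((1 - t) * x + t * y)) :
    (∫⁻ x, f x) ^ (1 - t) * (∫⁻ x, g x) ^ t ≤ ∫⁻ x, h x := by
  have h1 : 0 < 1 - t := by linarith
  set a := ⨆ x, f x with ha
  set b := ⨆ x, g x with hb
  have haN : a ≠ ∞ := ne_top_of_le_ne_top hN (iSup_le hfN)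
  have hbN : b ≠ ∞ := ne_top_of_le_ne_top hM (iSup_le hgN)
  rcases eq_or_ne a 0 with ha0 | ha0
  · have : ∀ x, f x = 0 := fun x => le_antisymm (ha0 ▸ le_iSup f x) bot_le
    simp [this, ENNReal.zero_rpow_of_pos h1]
  rcases eq_or_ne b 0 with hb0 | hb0
  · have : ∀ x, g x = 0 := fun x => le_antisymm (hb0 ▸ le_iSup g x) bot_le
    simp [this, ENNReal.zero_rpow_of_pos ht]
  set c := a ^ (1 - t) * b ^ t with hc
  have hc0 : c ≠ 0 := by simp [hc, haN, hbN, ha0, hb0]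
  have hcN : c ≠ ∞ :=
    ENNReal.mul_ne_top (ENNReal.rpow_ne_top_of_nonneg h1.le haN)
      (ENNReal.rpow_ne_top_of_nonneg ht.le hbN)
  have fa : ∀ x, f x / a ≤ 1 := fun x => ENNReal.div_le_of_le_mul (by simpa using le_iSup f x)
  have gb : ∀ x, g x / b ≤ 1 := fun x => ENNReal.div_le_of_le_mul (by simpa using le_iSup g x)
  have fa' : ∀ x, f x / a ≠ ∞ := fun x => ne_top_of_le_ne_top ENNReal.one_ne_top (fa x)
  have gb' : ∀ x, g x / b ≠ ∞ := fun x => ne_top_of_le_ne_top ENNReal.one_ne_top (gb x)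
  -- Truncating at 1 keeps the third function finite and costs nothing, since the normalized
  -- left-hand side is at most 1.
  have hc' : ∀ x, min (h x / c) 1 ≠ ∞ := fun x => by simp
  have sup : ∀ (k : ℝ → ℝ≥0∞), (⨆ x, k x) ≠ 0 → (⨆ x, k x) ≠ ∞ →
      ∀ s < (1 : ℝ), ∃ x, s < (k x / ⨆ x, k x).toReal := by
    intro k hk0 hk s hs
    have : ENNReal.ofReal s * (⨆ x, k x) < ⨆ x, k x := by
      conv_rhs => rw [← one_mul (⨆ x, k x)]
      exact (ENNReal.mul_lt_mul_iff_left hk0 hk).2 (by simpa using hs)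
    obtain ⟨x, hx⟩ := lt_iSup_iff.1 this
    refine ⟨x, ?_⟩
    rw [← ENNReal.lt_div_iff_mul_lt (.inl hk0) (.inl hk)] at hx
    rcases lt_or_ge s 0 with hs0 | hs0
    · exact lt_of_lt_of_le hs0 ENNReal.toReal_nonneg
    · refine (ENNReal.ofReal_lt_iff_lt_toReal hs0 ?_).1 hx
      exact ne_top_of_le_ne_top ENNReal.one_ne_top
        (ENNReal.div_le_of_le_mul (by simpa using le_iSup k x))
  have key := prekopa_leindler_of_sup_eq_one (f := fun x => (f x / a).toReal)
    (g := fun x => (g x / b).toReal) (h := fun x => (min (h x / c) 1).toReal) ht ht'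
    (by fun_prop) (by fun_prop) (by fun_prop) (fun _ => ENNReal.toReal_nonneg)
    (fun _ => ENNReal.toReal_nonneg) (fun _ => ENNReal.toReal_nonneg)
    (fun x => ENNReal.toReal_le_of_le_ofReal zero_le_one (by simpa using fa x))
    (fun x => ENNReal.toReal_le_of_le_ofReal zero_le_one (by simpa using gb x))
    (sup f ha0 haN) (sup g hb0 hbN) ?_
  · simp only [ENNReal.ofReal_toReal (fa' _), ENNReal.ofReal_toReal (gb' _),
      ENNReal.ofReal_toReal (hc' _)] at key
    have key' := ((ENNReal.rpow_mul_rpow_le_add ht ht' _ _).trans key).trans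
      (lintegral_mono fun x => min_le_left _ _)
    simp only [div_eq_mul_inv] at key'
    rw [lintegral_mul_const _ hf, lintegral_mul_const _ hg, lintegral_mul_const _ hh,
      ENNReal.mul_rpow_of_nonneg _ _ h1.le, ENNReal.mul_rpow_of_nonneg _ _ ht.le,
      mul_mul_mul_comm, ENNReal.inv_rpow, ENNReal.inv_rpow,
      ← ENNReal.mul_inv (by simp [haN, ha0]) (by simp [haN, ha0])] at key'
    exact (ENNReal.mul_le_mul_iff_left (ENNReal.inv_ne_zero.2 hcN)
      (ENNReal.inv_ne_top.2 hc0)).1 key'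
  · intro x y
    rw [ENNReal.toReal_rpow, ENNReal.toReal_rpow, ← ENNReal.toReal_mul]
    refine ENNReal.toReal_mono (hc' _) (le_min ?_ ?_)
    · rw [ENNReal.div_rpow_of_nonneg _ _ h1.le, ENNReal.div_rpow_of_nonneg _ _ ht.le,
        div_eq_mul_inv, div_eq_mul_inv, mul_mul_mul_comm,
        ← ENNReal.mul_inv (by simp [haN, ha0]) (by simp [haN, ha0]), div_eq_mul_inv]
      gcongr
      exact H x y
    · exact mul_le_one' (ENNReal.rpow_le_one (fa x) h1.le) (ENNReal.rpow_le_one (gb y) ht.le)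

/-- The Prékopa–Leindler inequality on the line. -/
theorem prekopa_leindler {f g h : ℝ → ℝ≥0∞} {t : ℝ} (ht : 0 < t) (ht' : t < 1)
    (hf : Measurable f) (hg : Measurable g) (hh : Measurable h)
    (H : ∀ x y, f x ^ (1 - t) * g y ^ t ≤ h ((1 - t) * x + t * y)) :
    (∫⁻ x, f x) ^ (1 - t) * (∫⁻ x, g x) ^ t ≤ ∫⁻ x, h x := by
  have h1 : 0 < 1 - t := by linarith
  have lim : ∀ k : ℝ → ℝ≥0∞, Measurable k →
      ∫⁻ x, k x = ⨆ N : ℕ, ∫⁻ x, min (k x) N := by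
    intro k hk
    rw [← lintegral_iSup (f := fun (N : ℕ) x => min (k x) N) (fun N => by fun_prop)
      (fun N M hNM x => min_le_min_left _ (by exact_mod_cast hNM))]
    congr with x
    rw [← inf_iSup_eq, ENNReal.iSup_natCast, inf_top_eq]
  rw [lim f hf, lim g hg]
  have e : ∀ (s : ℝ) (_ : 0 < s) (u : ℕ → ℝ≥0∞), (⨆ N, u N) ^ s = ⨆ N, u N ^ s :=
    fun s hs u => (ENNReal.orderIsoRpow s hs).map_iSup u
  simp only [e _ h1, e _ ht, ENNReal.iSup_mul, ENNReal.mul_iSup]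
  refine iSup_le fun N => iSup_le fun M => ?_
  refine prekopa_leindler_of_le ht ht' (by fun_prop) (by fun_prop) hh
    (ENNReal.natCast_ne_top _) (ENNReal.natCast_ne_top _) (fun x => min_le_right _ _)
    (fun x => min_le_right _ _) ?_
  intro x y
  refine le_trans ?_ (H x y)
  gcongr <;> exact min_le_left _ _

/-! ### Prékopa–Leindler for Gaussian measure, and Lipschitz concentration. -/

/-- This is (1 - t)x² + ty² = ((1 - t)x + ty)² + t(1 - t)(x - y)². The last term is the gain over
Lebesgue measure, and it pays for the Lipschitz increment later. -/
theorem gaussianPDF_rpow_mul_rpow (t x y : ℝ) :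
    gaussianPDF 0 1 x ^ (1 - t) * gaussianPDF 0 1 y ^ t =
      ENNReal.ofReal (Real.exp (-(t * (1 - t) / 2 * (x - y) ^ 2))) *
        gaussianPDF 0 1 ((1 - t) * x + t * y) := by
  have hc : (0 : ℝ) < (√(2 * Real.pi * (1 : NNReal)))⁻¹ := by
    have := Real.pi_pos
    simp only [NNReal.coe_one]
    positivity
  simp only [gaussianPDF]
  rw [ENNReal.ofReal_rpow_of_pos (gaussianPDFReal_pos _ _ _ one_ne_zero),
    ENNReal.ofReal_rpow_of_pos (gaussianPDFReal_pos _ _ _ one_ne_zero),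
    ← ENNReal.ofReal_mul (Real.rpow_nonneg (gaussianPDFReal_nonneg _ _ _) _),
    ← ENNReal.ofReal_mul (Real.exp_pos _).le]
  congr 1
  simp only [gaussianPDFReal]
  rw [Real.mul_rpow hc.le (Real.exp_pos _).le, Real.mul_rpow hc.le (Real.exp_pos _).le,
    ← Real.exp_mul, ← Real.exp_mul, mul_mul_mul_comm, ← Real.rpow_add hc, ← Real.exp_add,
    sub_add_cancel, Real.rpow_one, mul_left_comm, ← Real.exp_add]
  congr 2
  simp only [NNReal.coe_one]
  ring

/-- The Prékopa–Leindler inequality for the standard Gaussian measure on the line. -/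
theorem prekopa_leindler_gaussianReal {f g h : ℝ → ℝ≥0∞} {t : ℝ} (ht : 0 < t) (ht' : t < 1)
    (hf : Measurable f) (hg : Measurable g) (hh : Measurable h)
    (H : ∀ x y, f x ^ (1 - t) * g y ^ t ≤
      ENNReal.ofReal (Real.exp (t * (1 - t) / 2 * (x - y) ^ 2)) * h ((1 - t) * x + t * y)) :
    (∫⁻ x, f x ∂gaussianReal 0 1) ^ (1 - t) * (∫⁻ x, g x ∂gaussianReal 0 1) ^ t ≤
      ∫⁻ x, h x ∂gaussianReal 0 1 := by
  have h1 : 0 < 1 - t := by linarith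
  have hm : Measurable (gaussianPDF 0 1) := measurable_gaussianPDF 0 1
  rw [gaussianReal_of_var_ne_zero 0 one_ne_zero, lintegral_withDensity_eq_lintegral_mul _ hm hf,
    lintegral_withDensity_eq_lintegral_mul _ hm hg, lintegral_withDensity_eq_lintegral_mul _ hm hh]
  refine prekopa_leindler ht ht' (hm.mul hf) (hm.mul hg) (hm.mul hh) fun x y => ?_
  simp only [Pi.mul_apply]
  rw [ENNReal.mul_rpow_of_nonneg _ _ h1.le, ENNReal.mul_rpow_of_nonneg _ _ ht.le,
    mul_mul_mul_comm, gaussianPDF_rpow_mul_rpow]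
  calc _ ≤ ENNReal.ofReal (Real.exp (-(t * (1 - t) / 2 * (x - y) ^ 2))) *
        gaussianPDF 0 1 ((1 - t) * x + t * y) *
        (ENNReal.ofReal (Real.exp (t * (1 - t) / 2 * (x - y) ^ 2)) *
          h ((1 - t) * x + t * y)) := mul_le_mul' le_rfl (H x y)
    _ = (ENNReal.ofReal (Real.exp (-(t * (1 - t) / 2 * (x - y) ^ 2))) *
        ENNReal.ofReal (Real.exp (t * (1 - t) / 2 * (x - y) ^ 2))) *
        (gaussianPDF 0 1 ((1 - t) * x + t * y) * h ((1 - t) * x + t * y)) := by ring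
    _ = _ := by
      rw [← ENNReal.ofReal_mul (Real.exp_pos _).le, ← Real.exp_add]
      simp

theorem measurable_comp_finCons {n : ℕ} {f : (Fin (n + 1) → ℝ) → ℝ≥0∞} (hf : Measurable f) :
    Measurable fun p : ℝ × (Fin n → ℝ) => f (Fin.cons p.1 p.2) := by
  refine hf.comp (measurable_pi_iff.2 fun i => ?_)
  refine Fin.cases ?_ (fun j => ?_) i
  · simpa using measurable_fst
  · simp only [Fin.cons_succ]
    fun_prop

theorem lintegral_pi_fin_succ {ν : Measure ℝ} [SigmaFinite ν] {n : ℕ}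
    {f : (Fin (n + 1) → ℝ) → ℝ≥0∞} (hf : Measurable f) :
    ∫⁻ x, f x ∂Measure.pi (fun _ => ν) =
      ∫⁻ a, ∫⁻ x, f (Fin.cons a x) ∂Measure.pi (fun _ => ν) ∂ν := by
  have h := (measurePreserving_piFinSuccAbove (fun _ : Fin (n + 1) => ν) 0).symm
  rw [← h.lintegral_comp hf]
  refine (lintegral_prod _ (hf.comp h.measurable).aemeasurable).trans ?_
  refine lintegral_congr fun a => lintegral_congr fun x => ?_
  simp only [Function.comp_apply, MeasurableEquiv.piFinSuccAbove_symm_apply]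
  rw [Fin.insertNthEquiv_zero]
  rfl

/-- The Prékopa–Leindler inequality for the standard Gaussian measure on `ℝⁿ`. -/
theorem prekopa_leindler_pi_gaussianReal {t : ℝ} (ht : 0 < t) (ht' : t < 1) {n : ℕ}
    {f g h : (Fin n → ℝ) → ℝ≥0∞} (hf : Measurable f) (hg : Measurable g) (hh : Measurable h)
    (H : ∀ x y, f x ^ (1 - t) * g y ^ t ≤
      ENNReal.ofReal (Real.exp (t * (1 - t) / 2 * ∑ i, (x i - y i) ^ 2)) *
        h (fun i => (1 - t) * x i + t * y i)) :
    (∫⁻ x, f x ∂Measure.pi fun _ => gaussianReal 0 1) ^ (1 - t) *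
      (∫⁻ x, g x ∂Measure.pi fun _ => gaussianReal 0 1) ^ t ≤
      ∫⁻ x, h x ∂Measure.pi fun _ => gaussianReal 0 1 := by
  induction n with
  | zero =>
    have e : ∀ k : (Fin 0 → ℝ) → ℝ≥0∞,
        ∫⁻ x, k x ∂Measure.pi (fun _ => gaussianReal 0 1) = k 0 := by
      intro k
      rw [Measure.pi_of_empty _ 0]
      simp
    rw [e, e, e]
    refine (H 0 0).trans_eq ?_
    simp only [Finset.univ_eq_empty, Finset.sum_empty, mul_zero, Real.exp_zero, ENNReal.ofReal_one,
      one_mul]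
    congr 1
    exact Subsingleton.elim _ _
  | succ n ih =>
    rw [lintegral_pi_fin_succ hf, lintegral_pi_fin_succ hg, lintegral_pi_fin_succ hh]
    refine prekopa_leindler_gaussianReal ht ht' (measurable_comp_finCons hf).lintegral_prod_right'
      (measurable_comp_finCons hg).lintegral_prod_right'
      (measurable_comp_finCons hh).lintegral_prod_right' fun a b => ?_
    rw [← lintegral_const_mul (f := fun x => h (Fin.cons ((1 - t) * a + t * b) x)) _
      ((measurable_comp_finCons hh).comp measurable_prodMk_left)]
    refine ih ((measurable_comp_finCons hf).comp measurable_prodMk_left)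
      ((measurable_comp_finCons hg).comp measurable_prodMk_left)
      (((measurable_comp_finCons hh).comp measurable_prodMk_left).const_mul _) fun x y => ?_
    refine (H _ _).trans_eq ?_
    rw [← mul_assoc, ← ENNReal.ofReal_mul (Real.exp_pos _).le, ← Real.exp_add,
      Fin.sum_univ_succ]
    simp only [Fin.cons_zero, Fin.cons_succ]
    congr 3
    · ring
    · ext i
      refine Fin.cases ?_ (fun j => ?_) i <;> simp

/-- Prékopa–Leindler is applied with exponents -(t / (1 - t)) r (f - m) and r (f - m) and a constant
third function. The weighted exponents add up to t r (f y - f x), which the Gaussian gain absorbs.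
Jensen discards the first integral, and t → 0 yields the sharp constant. -/
theorem lintegral_exp_le_of_lipschitz {n : ℕ} {f : (Fin n → ℝ) → ℝ}
    (hfm : Measurable f)
    (hf : ∀ x y, f x - f y ≤ √(∑ i, (x i - y i) ^ 2))
    (hfi : Integrable f (Measure.pi fun _ => gaussianReal 0 1)) {r : ℝ} (hr : 0 ≤ r) :
    ∫⁻ x, ENNReal.ofReal (Real.exp (r * (f x - ∫ x, f x ∂Measure.pi fun _ => gaussianReal 0 1)))
      ∂Measure.pi (fun _ => gaussianReal 0 1) ≤ ENNReal.ofReal (Real.exp (r ^ 2 / 2)) := by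
  set γ : Measure (Fin n → ℝ) := Measure.pi fun _ => gaussianReal 0 1 with hγ
  set m := ∫ x, f x ∂γ with hm
  have main : ∀ t ∈ Ioo (0 : ℝ) 1,
      ∫⁻ x, ENNReal.ofReal (Real.exp (r * (f x - m))) ∂γ ≤
        ENNReal.ofReal (Real.exp (r ^ 2 / (2 * (1 - t)))) := by
    rintro t ⟨ht, ht'⟩
    have h1 : 0 < 1 - t := by linarith
    have PL := prekopa_leindler_pi_gaussianReal ht ht' (n := n)
      (f := fun x => ENNReal.ofReal (Real.exp (-(t / (1 - t) * (r * (f x - m))))))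
      (g := fun x => ENNReal.ofReal (Real.exp (r * (f x - m))))
      (h := fun _ => ENNReal.ofReal (Real.exp (t * (r ^ 2 / (2 * (1 - t))))))
      (by fun_prop) (by fun_prop) (by fun_prop) ?_
    · rw [lintegral_const, measure_univ, mul_one] at PL
      have J : 1 ≤ ∫⁻ x, ENNReal.ofReal (Real.exp (-(t / (1 - t) * (r * (f x - m))))) ∂γ := by
        have hi' : Integrable (fun x => t / (1 - t) * (r * (f x - m))) γ :=
          ((hfi.sub (integrable_const m)).const_mul r).const_mul _
        have hi : Integrable (fun x => 1 - t / (1 - t) * (r * (f x - m))) γ :=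
          (integrable_const _).sub hi'
        have e : ∫ x, (1 - t / (1 - t) * (r * (f x - m))) ∂γ = 1 := by
          rw [integral_sub (integrable_const _) hi', integral_const_mul,
            integral_const_mul, integral_sub hfi (integrable_const m)]
          simp [hm]
        calc (1 : ℝ≥0∞) = ENNReal.ofReal (∫ x, (1 - t / (1 - t) * (r * (f x - m))) ∂γ) := by
              rw [e, ENNReal.ofReal_one]
          _ ≤ ∫⁻ x, ENNReal.ofReal (1 - t / (1 - t) * (r * (f x - m))) ∂γ :=
              by
              rw [integral_eq_lintegral_pos_part_sub_lintegral_neg_part hi]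
              exact (ENNReal.ofReal_le_ofReal (sub_le_self _ ENNReal.toReal_nonneg)).trans
                ENNReal.ofReal_toReal_le
          _ ≤ _ := by
              refine lintegral_mono fun x => ENNReal.ofReal_le_ofReal ?_
              have := Real.add_one_le_exp (-(t / (1 - t) * (r * (f x - m))))
              linarith
      have K : (∫⁻ x, ENNReal.ofReal (Real.exp (r * (f x - m))) ∂γ) ^ t ≤
          ENNReal.ofReal (Real.exp (t * (r ^ 2 / (2 * (1 - t))))) := by
        refine le_trans ?_ PL
        conv_lhs => rw [← one_mul ((∫⁻ x, ENNReal.ofReal (Real.exp (r * (f x - m))) ∂γ) ^ t)]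
        gcongr
        exact ENNReal.one_le_rpow J h1
      rw [mul_comm t, Real.exp_mul, ← ENNReal.ofReal_rpow_of_pos (Real.exp_pos _)] at K
      exact (ENNReal.rpow_le_rpow_iff ht).1 K
    · intro x y
      rw [ENNReal.ofReal_rpow_of_pos (Real.exp_pos _), ENNReal.ofReal_rpow_of_pos (Real.exp_pos _),
        ← Real.exp_mul, ← Real.exp_mul, ← ENNReal.ofReal_mul (Real.exp_pos _).le,
        ← ENNReal.ofReal_mul (Real.exp_pos _).le, ← Real.exp_add, ← Real.exp_add]
      refine ENNReal.ofReal_le_ofReal (Real.exp_le_exp.2 ?_)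
      set d := √(∑ i, (x i - y i) ^ 2) with hd
      have hd2 : ∑ i, (x i - y i) ^ 2 = d ^ 2 :=
        (Real.sq_sqrt (Finset.sum_nonneg fun i _ => sq_nonneg _)).symm
      have hxy : f y - f x ≤ d := by
        refine (hf y x).trans_eq ?_
        rw [hd]
        congr 2 with i
        ring
      rw [hd2]
      have e1 : -(t / (1 - t) * (r * (f x - m))) * (1 - t) + r * (f y - m) * t =
          t * (r * (f y - f x)) := by
        field_simp
        ring
      -- Completing the square in d explains the constant r² / (2(1 - t)).
      have e2 : t * (1 - t) / 2 * d ^ 2 + t * (r ^ 2 / (2 * (1 - t))) - t * (r * d) =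
          t / (2 * (1 - t)) * ((1 - t) * d - r) ^ 2 := by
        field_simp
        ring
      have e3 : 0 ≤ t / (2 * (1 - t)) * ((1 - t) * d - r) ^ 2 := by positivity
      have e4 : t * (r * (f y - f x)) ≤ t * (r * d) := by gcongr
      rw [e1]
      linarith
  have lim : Filter.Tendsto (fun t : ℝ => ENNReal.ofReal (Real.exp (r ^ 2 / (2 * (1 - t)))))
      (nhdsWithin 0 (Ioi 0)) (nhds (ENNReal.ofReal (Real.exp (r ^ 2 / 2)))) := by
    have : ContinuousAt (fun t : ℝ => ENNReal.ofReal (Real.exp (r ^ 2 / (2 * (1 - t))))) 0 := by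
      refine ENNReal.continuous_ofReal.continuousAt.comp (Real.continuous_exp.continuousAt.comp ?_)
      exact ContinuousAt.div (by fun_prop) (by fun_prop) (by norm_num)
    have h := this.tendsto.mono_left (nhdsWithin_le_nhds (s := Ioi (0 : ℝ)))
    simpa using h
  refine ge_of_tendsto lim ?_
  filter_upwards [Ioo_mem_nhdsGT (show (0 : ℝ) < 1 by norm_num)] with t ht using main t ht

/-- Gaussian concentration: a `1`-Lipschitz function exceeds its mean by `r` with probability at
most `exp (- r ^ 2 / 2)`. -/
theorem measure_pi_gaussianReal_lipschitz_ge_le {n : ℕ} {f : (Fin n → ℝ) → ℝ}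
    (hfm : Measurable f) (hf : ∀ x y, f x - f y ≤ √(∑ i, (x i - y i) ^ 2))
    (hfi : Integrable f (Measure.pi fun _ => gaussianReal 0 1)) {m r : ℝ}
    (hm : ∫ x, f x ∂(Measure.pi fun _ => gaussianReal 0 1) ≤ m) (hr : 0 ≤ r) :
    (Measure.pi fun _ => gaussianReal 0 1) {x | m + r ≤ f x} ≤
      ENNReal.ofReal (Real.exp (-(r ^ 2 / 2))) := by
  set γ : Measure (Fin n → ℝ) := Measure.pi fun _ => gaussianReal 0 1 with hγ
  have h := lintegral_exp_le_of_lipschitz hfm hf hfi hr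
  rw [← hγ] at h
  have h2 := mul_meas_ge_le_lintegral₀ (μ := γ)
    (f := fun x => ENNReal.ofReal (Real.exp (r * (f x - ∫ x, f x ∂γ)))) (by fun_prop)
    (ENNReal.ofReal (Real.exp (r ^ 2)))
  have h3 : γ {x | m + r ≤ f x} ≤ γ {x | ENNReal.ofReal (Real.exp (r ^ 2)) ≤
      ENNReal.ofReal (Real.exp (r * (f x - ∫ x, f x ∂γ)))} := by
    refine measure_mono fun x hx => ENNReal.ofReal_le_ofReal (Real.exp_le_exp.2 ?_)
    have : m + r ≤ f x := hx
    nlinarith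
  have h4 := (mul_le_mul_right h3 (ENNReal.ofReal (Real.exp (r ^ 2)))).trans (h2.trans h)
  rw [mul_comm] at h4
  have h5 : ENNReal.ofReal (Real.exp (r ^ 2)) ≠ 0 := by simp [Real.exp_pos]
  refine (ENNReal.mul_le_mul_iff_left h5 ENNReal.ofReal_ne_top).1 (h4.trans_eq ?_)
  rw [← ENNReal.ofReal_mul (Real.exp_pos _).le, ← Real.exp_add]
  congr 2
  ring

/-! ### Maximal partial sums. -/

/-- The maximum of the partial sums `y 0 + ⋯ + y (j - 1)` over `0 ≤ j ≤ n`. -/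
def maxPartialSum : ℕ → (ℕ → ℝ) → ℝ
  | 0, _ => 0
  | n + 1, y => max 0 (y 0 + maxPartialSum n fun i => y (i + 1))

theorem maxPartialSum_nonneg (n : ℕ) (y : ℕ → ℝ) : 0 ≤ maxPartialSum n y := by
  cases n with
  | zero => exact le_rfl
  | succ n => exact le_max_left _ _

theorem maxPartialSum_congr {n : ℕ} {y z : ℕ → ℝ} (h : ∀ i < n, y i = z i) :
    maxPartialSum n y = maxPartialSum n z := by
  induction n generalizing y z with
  | zero => rfl
  | succ n ih =>
    simp only [maxPartialSum]
    rw [h 0 n.succ_pos, ih fun i hi => h (i + 1) (by omega)]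

theorem sum_range_le_maxPartialSum {n j : ℕ} (hj : j ≤ n) (y : ℕ → ℝ) :
    ∑ i ∈ Finset.range j, y i ≤ maxPartialSum n y := by
  induction n generalizing j y with
  | zero => simp [Nat.le_zero.1 hj, maxPartialSum]
  | succ n ih =>
    cases j with
    | zero => simpa using maxPartialSum_nonneg _ _
    | succ j =>
      rw [Finset.sum_range_succ']
      refine le_max_of_le_right ?_
      have := ih (Nat.le_of_succ_le_succ hj) fun i => y (i + 1)
      linarith

theorem maxPartialSum_le_sum_abs (n : ℕ) (y : ℕ → ℝ) :
    maxPartialSum n y ≤ ∑ i ∈ Finset.range n, |y i| := by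
  induction n generalizing y with
  | zero => simp [maxPartialSum]
  | succ n ih =>
    rw [Finset.sum_range_succ']
    have h := ih fun i => y (i + 1)
    have h0 : 0 ≤ ∑ i ∈ Finset.range n, |y (i + 1)| := Finset.sum_nonneg fun _ _ => abs_nonneg _
    refine max_le (by positivity) ?_
    have := le_abs_self (y 0)
    linarith

theorem maxPartialSum_succ_eq_max (n : ℕ) (y : ℕ → ℝ) :
    maxPartialSum (n + 1) y = max (maxPartialSum n y) (∑ i ∈ Finset.range (n + 1), y i) := by
  induction n generalizing y with
  | zero => simp [maxPartialSum]
  | succ n ih =>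
    rw [maxPartialSum, ih, maxPartialSum, Finset.sum_range_succ' _ (n + 1), max_assoc,
      ← max_add_add_left, add_comm (y 0) (∑ i ∈ _, _)]

/-- A positive total means that the empty sum is not the maximum, so the first term is always used.
Together with the nonpositive case this is the dichotomy behind Spitzer's identity. -/
theorem maxPartialSum_succ_of_pos {n : ℕ} {y : ℕ → ℝ}
    (h : 0 < ∑ i ∈ Finset.range (n + 1), y i) :
    maxPartialSum (n + 1) y = y 0 + maxPartialSum n fun i => y (i + 1) := by
  refine max_eq_right (h.le.trans ?_)
  rw [Finset.sum_range_succ', add_comm]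
  gcongr
  exact sum_range_le_maxPartialSum le_rfl _

theorem maxPartialSum_succ_of_nonpos {n : ℕ} {y : ℕ → ℝ}
    (h : ∑ i ∈ Finset.range (n + 1), y i ≤ 0) :
    maxPartialSum (n + 1) y = maxPartialSum n y := by
  rw [maxPartialSum_succ_eq_max]
  exact max_eq_left (h.trans (maxPartialSum_nonneg _ _))

theorem measurable_maxPartialSum {α : Type*} [MeasurableSpace α] (n : ℕ) {y : α → ℕ → ℝ}
    (hy : ∀ i, Measurable fun x => y x i) : Measurable fun x => maxPartialSum n (y x) := by
  induction n generalizing y with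
  | zero => exact measurable_const
  | succ n ih => exact measurable_const.max ((hy 0).add (ih fun i => hy (i + 1)))

/-! ### Exchangeability and Spitzer's identity. -/

section Exchangeable

variable {ι : Type*} [Fintype ι] (ν : Measure ℝ) [IsProbabilityMeasure ν]

/-- Two injective selections of n coordinates differ by a permutation of `ι`, and permutations
preserve a product of equal factors. -/
theorem exists_measurePreserving_pi_apply_eq {n : ℕ} {e e' : ℕ → ι}
    (he : InjOn e (Iio n)) (he' : InjOn e' (Iio n)) :
    ∃ T : (ι → ℝ) ≃ᵐ (ι → ℝ),
      MeasurePreserving T (Measure.pi fun _ => ν) (Measure.pi fun _ => ν) ∧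
        ∀ x, ∀ i < n, T x (e i) = x (e' i) := by
  classical
  let emb : ∀ f : ℕ → ι, InjOn f (Iio n) → (Fin n ↪ ι) := fun f hf =>
    ⟨fun i => f i, fun i j hij => Fin.ext (hf i.2 j.2 hij)⟩
  obtain ⟨σ, hσ⟩ := (Equiv.Perm.isMultiplyPretransitive ι n).exists_smul_eq (emb e' he') (emb e he)
  refine ⟨MeasurableEquiv.piCongrLeft (fun _ => ℝ) σ,
    measurePreserving_piCongrLeft (fun _ => ν) σ, fun x i hi => ?_⟩
  have h : σ (e' i) = e i := congrArg (fun f : Fin n ↪ ι => f ⟨i, hi⟩) hσ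
  rw [← h]
  exact Equiv.piCongrLeft_apply_apply (fun _ => ℝ) σ x (e' i)

theorem integral_pi_comp_eq {n : ℕ} {e e' : ℕ → ι} (he : InjOn e (Iio n))
    (he' : InjOn e' (Iio n)) {G : (ℕ → ℝ) → ℝ} (hG : ∀ y z, (∀ i < n, y i = z i) → G y = G z) :
    ∫ x, G (fun i => x (e i)) ∂(Measure.pi fun _ => ν) =
      ∫ x, G (fun i => x (e' i)) ∂(Measure.pi fun _ => ν) := by
  obtain ⟨T, hT, h⟩ := exists_measurePreserving_pi_apply_eq ν he he'
  rw [← hT.integral_comp' (f := T)]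
  exact integral_congr_ae (.of_forall fun x => hG _ _ (h x))

variable {ν} {φ : ℝ → ℝ}

theorem integrable_comp_eval_pi (hφ : Integrable φ ν) (i : ι) :
    Integrable (fun x : ι → ℝ => φ (x i)) (Measure.pi fun _ => ν) :=
  (measurePreserving_eval (fun _ => ν) i).integrable_comp_of_integrable hφ

theorem integrable_maxPartialSum (hφ : Integrable φ ν) (hφm : Measurable φ) (n : ℕ) (e : ℕ → ι) :
    Integrable (fun x : ι → ℝ => maxPartialSum n fun i => φ (x (e i)))
      (Measure.pi fun _ => ν) := by
  refine Integrable.mono' (g := fun x => ∑ i ∈ Finset.range n, |φ (x (e i))|)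
    (integrable_finsetSum _ fun i _ => (integrable_comp_eval_pi hφ (e i)).abs)
    (measurable_maxPartialSum n fun i => by fun_prop).aestronglyMeasurable (.of_forall fun x => ?_)
  rw [Real.norm_of_nonneg (maxPartialSum_nonneg _ _)]
  exact maxPartialSum_le_sum_abs _ _

/-- **Spitzer's identity** for the mean of the maximum of a random walk. -/
theorem integral_maxPartialSum (hφ : Integrable φ ν) (hφm : Measurable φ) {n : ℕ} {e : ℕ → ι}
    (he : InjOn e (Iio n)) :
    ∫ x, maxPartialSum n (fun i => φ (x (e i))) ∂(Measure.pi fun _ => ν) =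
      ∑ k ∈ Finset.range n, (∫ x, max (∑ i ∈ Finset.range (k + 1), φ (x (e i))) 0
        ∂(Measure.pi fun _ => ν)) / (k + 1) := by
  induction n with
  | zero => simp [maxPartialSum]
  | succ n ih =>
    set γ : Measure (ι → ℝ) := Measure.pi fun _ => ν with hγ
    have he' : InjOn e (Iio n) := he.mono (Iio_subset_Iio n.le_succ)
    rw [Finset.sum_range_succ, ← ih he']
    set S : (ℕ → ℝ) → ℝ := fun y => ∑ i ∈ Finset.range (n + 1), φ (y i) with hS
    have hScongr : ∀ y z : ℕ → ℝ, (∀ i < n + 1, y i = z i) → S y = S z := fun y z h =>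
      Finset.sum_congr rfl fun i hi => by rw [h i (Finset.mem_range.1 hi)]
    set P : Set (ι → ℝ) := {x | 0 < S fun i => x (e i)} with hP
    have hSm : Measurable fun x : ι → ℝ => S fun i => x (e i) := by
      simp only [hS]; fun_prop
    have hPm : MeasurableSet P := measurableSet_lt measurable_const hSm
    -- After taking means, exchangeability replaces the shifted maximum on `P` by the unshifted one.
    -- The increment in n is then the mean of the first term on `P`, which is the mean of S⁺ divided
    -- by n + 1.
    have hsplit : ∀ x : ι → ℝ, maxPartialSum (n + 1) (fun i => φ (x (e i))) =
        P.indicator (fun x => φ (x (e 0))) x +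
        (P.indicator (fun x => maxPartialSum n fun i => φ (x (e (i + 1)))) x +
          Pᶜ.indicator (fun x => maxPartialSum n fun i => φ (x (e i))) x) := by
      intro x
      by_cases hx : x ∈ P
      · rw [maxPartialSum_succ_of_pos hx]
        simp [hx]
      · rw [maxPartialSum_succ_of_nonpos (not_lt.1 hx)]
        simp [hx]
    have i1 : ∀ j, Integrable (P.indicator fun x : ι → ℝ => φ (x (e j))) γ := fun j =>
      (integrable_comp_eval_pi hφ (e j)).indicator hPm
    have i2 : Integrable (P.indicator fun x => maxPartialSum n fun i => φ (x (e (i + 1)))) γ :=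
      (integrable_maxPartialSum hφ hφm n fun i => e (i + 1)).indicator hPm
    have i3 : Integrable (Pᶜ.indicator fun x => maxPartialSum n fun i => φ (x (e i))) γ :=
      (integrable_maxPartialSum hφ hφm n e).indicator hPm.compl
    have i4 : Integrable (P.indicator fun x => maxPartialSum n fun i => φ (x (e i))) γ :=
      (integrable_maxPartialSum hφ hφm n e).indicator hPm
    have hshift : ∫ x, P.indicator (fun x => maxPartialSum n fun i => φ (x (e (i + 1)))) x ∂γ =
        ∫ x, P.indicator (fun x => maxPartialSum n fun i => φ (x (e i))) x ∂γ := by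
      -- A cyclic rotation leaves the total, hence `P`, unchanged and moves the window 1, …, n to 0,
      -- …, n - 1.
      set e' : ℕ → ι := fun i => if i = 0 then e n else e (i - 1) with he'def
      have hinj : InjOn e' (Iio (n + 1)) := by
        intro i hi j hj hij
        simp only [he'def, mem_Iio] at hi hj hij
        split_ifs at hij with h1 h2 h2
        · omega
        · have := he (by simp) (by simp; omega) hij
          omega
        · have := he (by simp; omega) (by simp) hij
          omega
        · have := he (by simp; omega) (by simp; omega) hij
          omega
      have hSe : ∀ x : ι → ℝ, S (fun i => x (e' i)) = S fun i => x (e i) := by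
        intro x
        simp only [hS]
        rw [Finset.sum_range_succ', Finset.sum_range_succ]
        simp [he'def]
      have := integral_pi_comp_eq ν he hinj (G := fun y =>
        if 0 < S y then maxPartialSum n fun i => φ (y (i + 1)) else 0) (fun y z h => by
          simp only [hScongr y z h]
          rw [maxPartialSum_congr fun i hi => by rw [h (i + 1) (by omega)]])
      simp only [hSe] at this
      simpa [indicator, hP, he'def] using this
    have hswap : ∀ j < n + 1, ∫ x, P.indicator (fun x => φ (x (e j))) x ∂γ =
        ∫ x, P.indicator (fun x => φ (x (e 0))) x ∂γ := by
      intro j hj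
      set τ := Equiv.swap 0 j with hτ
      have hτm : ∀ i ∈ Finset.range (n + 1), τ i ∈ Finset.range (n + 1) := by
        intro i hi
        rw [hτ, Equiv.swap_apply_def]
        split_ifs <;> simp_all
      have hinj : InjOn (fun i => e (τ i)) (Iio (n + 1)) := fun i hi k hk hik =>
        τ.injective (he (by simpa using hτm i (by simpa using hi))
          (by simpa using hτm k (by simpa using hk)) hik)
      have hSe : ∀ x : ι → ℝ, S (fun i => x (e (τ i))) = S fun i => x (e i) := by
        intro x
        simp only [hS]
        exact Finset.sum_bij' (fun i _ => τ i) (fun i _ => τ i) hτm hτm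
          (fun i _ => by simp [hτ]) (fun i _ => by simp [hτ]) fun _ _ => rfl
      have := integral_pi_comp_eq ν he hinj (G := fun y =>
        if 0 < S y then φ (y 0) else 0) (fun y z h => by
          simp only [hScongr y z h, h 0 n.succ_pos])
      simp only [hSe] at this
      simpa [indicator, hP, hτ] using this.symm
    have hsum : ∫ x, max (S fun i => x (e i)) 0 ∂γ =
        (n + 1) * ∫ x, P.indicator (fun x => φ (x (e 0))) x ∂γ := by
      have : ∀ x : ι → ℝ, max (S fun i => x (e i)) 0 =
          ∑ j ∈ Finset.range (n + 1), P.indicator (fun x => φ (x (e j))) x := by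
        intro x
        by_cases hx : x ∈ P
        · simp only [indicator_of_mem hx]
          exact max_eq_left (le_of_lt hx)
        · simp only [indicator_of_notMem hx, Finset.sum_const_zero]
          exact max_eq_right (not_lt.1 hx)
      simp only [this]
      rw [integral_finsetSum _ fun j _ => i1 j,
        Finset.sum_congr rfl fun j hj => hswap j (Finset.mem_range.1 hj)]
      simp
    have hadd : ∫ x, P.indicator (fun x => maxPartialSum n fun i => φ (x (e i))) x ∂γ +
        ∫ x, Pᶜ.indicator (fun x => maxPartialSum n fun i => φ (x (e i))) x ∂γ =
        ∫ x, maxPartialSum n (fun i => φ (x (e i))) ∂γ := by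
      rw [← integral_add i4 i3]
      refine integral_congr_ae (.of_forall fun x => ?_)
      exact congrFun (indicator_self_add_compl P _) x
    simp only [hsplit]
    have i23 : Integrable (fun x =>
        P.indicator (fun x => maxPartialSum n fun i => φ (x (e (i + 1)))) x +
          Pᶜ.indicator (fun x => maxPartialSum n fun i => φ (x (e i))) x) γ := i2.add i3
    rw [integral_add (i1 0) i23, integral_add i2 i3, hshift, hadd]
    have hn : (n + 1 : ℝ) ≠ 0 := by positivity
    rw [show (∫ x, max (∑ i ∈ Finset.range (n + 1), φ (x (e i))) 0 ∂γ) = _ from hsum]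
    field_simp
    ring

end Exchangeable

/-! ### The conjugate of half the squared norm on monotone sequences. -/

/-- The integral over all levels `a > 0` of the maximal partial sum of `y - a`. It bounds the
value of the conjugate of `‖·‖² / 2` on nonnegative antitone sequences. -/
noncomputable def antitoneExcess (n : ℕ) (y : ℕ → ℝ) : ℝ≥0∞ :=
  ∫⁻ a in Ioi (0 : ℝ), ENNReal.ofReal (maxPartialSum n fun i => y i - a)

theorem measurable_antitoneExcess {α : Type*} [MeasurableSpace α] (n : ℕ) {y : α → ℕ → ℝ}
    (hy : ∀ i, Measurable fun x => y x i) : Measurable fun x => antitoneExcess n (y x) := by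
  refine Measurable.lintegral_prod_right'
    (f := fun p : α × ℝ => ENNReal.ofReal (maxPartialSum n fun i => y p.1 i - p.2)) ?_
  refine ENNReal.measurable_ofReal.comp (measurable_maxPartialSum n fun i => ?_)
  exact ((hy i).comp measurable_fst).sub measurable_snd

/-- For antitone v the set {v > a} is an initial segment, so the sum over it is one of the partial
sums. -/
theorem sum_indicator_le_maxPartialSum {n : ℕ} {v : ℕ → ℝ} (hv : AntitoneOn v (Iio n))
    (y : ℕ → ℝ) (a : ℝ) :
    ∑ i ∈ Finset.range n, (Iio (v i)).indicator (fun a => y i - a) a ≤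
      maxPartialSum n fun i => y i - a := by
  classical
  have hex : ∃ j, n ≤ j ∨ v j ≤ a := ⟨n, .inl le_rfl⟩
  set j := Nat.find hex with hj
  have hjn : j ≤ n := Nat.find_min' hex (.inl le_rfl)
  refine le_trans (le_of_eq ?_) (sum_range_le_maxPartialSum hjn _)
  rw [← Finset.sum_range_add_sum_Ico _ hjn, Finset.sum_congr rfl (g := fun i => y i - a),
    Finset.sum_eq_zero (s := Finset.Ico j n), add_zero]
  · intro i hi
    rw [Finset.mem_Ico] at hi
    refine indicator_of_notMem (s := Iio (v i)) (fun ha => not_lt.2 ?_ (mem_Iio.1 ha)) _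
    rcases Nat.find_spec hex with h | h
    · exact absurd (h.trans hi.1) (by omega)
    · exact (hv (show j < n by omega) hi.2 hi.1).trans h
  · intro i hi
    have := Nat.find_min hex (Finset.mem_range.1 hi)
    push Not at this
    exact indicator_of_mem (show a ∈ Iio (v i) from this.2) _

theorem integral_Ioi_indicator_Iio (y v : ℝ) :
    ∫ a in Ioi (0 : ℝ), (Iio v).indicator (fun a => y - a) a =
      y * max v 0 - max v 0 ^ 2 / 2 := by
  have e : Ioi (0 : ℝ) ∩ Iio v = Ioo 0 (max v 0) := by
    ext a
    simp only [mem_inter_iff, mem_Ioi, mem_Iio, mem_Ioo, lt_max_iff]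
    constructor
    · rintro ⟨h1, h2⟩; exact ⟨h1, .inl h2⟩
    · rintro ⟨h1, h2 | h2⟩
      · exact ⟨h1, h2⟩
      · linarith
  rw [setIntegral_indicator measurableSet_Iio, e, ← integral_Ioc_eq_integral_Ioo,
    ← intervalIntegral.integral_of_le (le_max_right _ _), intervalIntegral.integral_sub
      (by simp) (by simp)]
  simp
  ring

theorem integrableOn_Ioi_indicator_Iio (y v : ℝ) :
    IntegrableOn ((Iio v).indicator fun a => y - a) (Ioi (0 : ℝ)) := by
  rw [IntegrableOn, integrable_indicator_iff measurableSet_Iio, IntegrableOn,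
    Measure.restrict_restrict measurableSet_Iio]
  exact (ContinuousOn.integrableOn_Icc (f := fun a => y - a) (a := 0) (b := v)
    (by fun_prop)).mono_set fun a ha => ⟨le_of_lt ha.2, le_of_lt ha.1⟩

/-- Layer cake: y v⁺ - (v⁺)²/2 is the integral of y - a over 0 < a < v⁺, so the bound at each level
can be integrated. -/
theorem ofReal_sum_posPart_le_antitoneExcess {n : ℕ} {v : ℕ → ℝ} (hv : AntitoneOn v (Iio n))
    (y : ℕ → ℝ) :
    ENNReal.ofReal (∑ i ∈ Finset.range n, (y i * max (v i) 0 - max (v i) 0 ^ 2 / 2)) ≤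
      antitoneExcess n y := by
  have hi : Integrable (fun a => ∑ i ∈ Finset.range n, (Iio (v i)).indicator (fun a => y i - a) a)
      (volume.restrict (Ioi (0 : ℝ))) :=
    integrable_finsetSum _ fun i _ => integrableOn_Ioi_indicator_Iio _ _
  have e : ∫ a in Ioi (0 : ℝ), ∑ i ∈ Finset.range n, (Iio (v i)).indicator (fun a => y i - a) a =
      ∑ i ∈ Finset.range n, (y i * max (v i) 0 - max (v i) 0 ^ 2 / 2) := by
    rw [integral_finsetSum _ fun i _ => integrableOn_Ioi_indicator_Iio _ _]
    exact Finset.sum_congr rfl fun i _ => integral_Ioi_indicator_Iio _ _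
  rw [← e, integral_eq_lintegral_pos_part_sub_lintegral_neg_part hi]
  refine (ENNReal.ofReal_le_ofReal (sub_le_self _ ENNReal.toReal_nonneg)).trans
    (ENNReal.ofReal_toReal_le.trans ?_)
  exact lintegral_mono fun a => ENNReal.ofReal_le_ofReal (sum_indicator_le_maxPartialSum hv y a)

/-- At each index one of v⁺, v⁻ vanishes, so the functional splits. Reversing the order makes v⁻
antitone; it is paired with -y. -/
theorem ofReal_sum_le_antitoneExcess_add {n : ℕ} {v : ℕ → ℝ} (hv : AntitoneOn v (Iio n))
    (y : ℕ → ℝ) :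
    ENNReal.ofReal (∑ i ∈ Finset.range n, (y i * v i - v i ^ 2 / 2)) ≤
      antitoneExcess n y + antitoneExcess n fun i => -y (n - 1 - i) := by
  have hw : AntitoneOn (fun i => -v (n - 1 - i)) (Iio n) := by
    intro i hi j hj hij
    simp only [mem_Iio] at hi hj
    exact neg_le_neg (hv (show n - 1 - j < n by omega) (show n - 1 - i < n by omega) (by omega))
  have h := add_le_add (ofReal_sum_posPart_le_antitoneExcess hv y)
    (ofReal_sum_posPart_le_antitoneExcess hw fun i => -y (n - 1 - i))
  refine le_trans (le_trans (ENNReal.ofReal_le_ofReal (le_of_eq ?_)) ENNReal.ofReal_add_le) h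
  rw [Finset.sum_range_reflect (fun i => -y i * max (-v i) 0 - max (-v i) 0 ^ 2 / 2) n,
    ← Finset.sum_add_distrib]
  refine Finset.sum_congr rfl fun i _ => ?_
  rcases le_total 0 (v i) with h | h
  · rw [max_eq_left h, max_eq_right (neg_nonpos.2 h)]; ring
  · rw [max_eq_right h, max_eq_left (neg_nonneg.2 h)]; ring

theorem lintegral_Ioi_ofReal_sub_mul (s : ℝ) {c : ℝ} (hc : 0 < c) :
    ∫⁻ a in Ioi (0 : ℝ), ENNReal.ofReal (s - c * a) = ENNReal.ofReal (max s 0 ^ 2 / (2 * c)) := by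
  have hb : 0 ≤ max s 0 / c := by positivity
  rw [← Ioc_union_Ioi_eq_Ioi hb, lintegral_union measurableSet_Ioi
    (Set.disjoint_left.2 fun a ha ha' => not_lt.2 ha.2 ha')]
  have h2 : ∫⁻ a in Ioi (max s 0 / c), ENNReal.ofReal (s - c * a) = 0 := by
    rw [setLIntegral_congr_fun (g := fun _ => 0) measurableSet_Ioi, lintegral_zero]
    intro a ha
    have : max s 0 < a * c := (div_lt_iff₀ hc).1 ha
    have := le_max_left s 0
    exact ENNReal.ofReal_of_nonpos (by linarith)
  rw [h2, add_zero, setLIntegral_congr_fun (g := fun a => ENNReal.ofReal (max s 0 - c * a))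
    measurableSet_Ioc, ← ofReal_integral_eq_lintegral_ofReal]
  · congr 1
    rw [← intervalIntegral.integral_of_le hb, intervalIntegral.integral_sub (by simp)
      (Continuous.intervalIntegrable (by fun_prop) _ _)]
    rw [intervalIntegral.integral_const_mul, integral_id, intervalIntegral.integral_const]
    simp only [smul_eq_mul]
    field_simp
    ring
  · exact (ContinuousOn.integrableOn_Icc (by fun_prop)).mono_set Ioc_subset_Icc_self
  · refine (ae_restrict_iff' measurableSet_Ioc).2 (.of_forall fun a ha => ?_)
    have : a * c ≤ max s 0 := (le_div_iff₀ hc).1 ha.2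
    simp only [Pi.zero_apply]
    linarith
  · intro a ha
    rcases le_total 0 s with h | h
    · simp [max_eq_left h]
    · have := ha.1
      have := ha.2
      rw [max_eq_right h, zero_div] at this
      linarith

/-! ### The mean excess of Gaussian noise. -/

section Gaussian

variable {ι : Type*} [Fintype ι]

theorem memLp_eval_pi_gaussianReal (i : ι) :
    MemLp (fun x : ι → ℝ => x i) 2 (Measure.pi fun _ => gaussianReal 0 1) :=
  (memLp_id_gaussianReal 2).comp_measurePreserving
    (measurePreserving_eval (fun _ => gaussianReal 0 1) i)

theorem integral_sq_sum_pi_gaussianReal {n : ℕ} {e : ℕ → ι} (he : InjOn e (Iio n)) :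
    ∫ x : ι → ℝ, (∑ i ∈ Finset.range n, x (e i)) ^ 2 ∂(Measure.pi fun _ => gaussianReal 0 1) =
      n := by
  classical
  set γ : Measure (ι → ℝ) := Measure.pi fun _ => gaussianReal 0 1 with hγ
  set A := (Finset.range n).image e with hA
  have hinj : InjOn e (Finset.range n) := by simpa using he
  have hsum : ∀ x : ι → ℝ, ∑ i ∈ Finset.range n, x (e i) =
      ∑ j, (if j ∈ A then x j else 0) := by
    intro x
    rw [Finset.sum_ite_mem, Finset.univ_inter, hA, Finset.sum_image hinj]
  have hX : ∀ j : ι, MemLp (fun z : ℝ => if j ∈ A then z else 0) 2 (gaussianReal 0 1) := by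
    intro j
    split_ifs
    · exact memLp_id_gaussianReal 2
    · exact MemLp.zero'
  have hv := variance_sum_pi (μ := fun _ : ι => gaussianReal 0 1) hX
  have hcard : A.card = n := by rw [hA, Finset.card_image_of_injOn hinj, Finset.card_range]
  have hvar : ∀ j, Var[fun z : ℝ => if j ∈ A then z else 0; gaussianReal 0 1] =
      if j ∈ A then 1 else 0 := by
    intro j
    split_ifs
    · exact variance_fun_id_gaussianReal
    · exact variance_zero _
  rw [Finset.sum_congr rfl fun j _ => hvar j, Finset.sum_ite_mem, Finset.univ_inter,
    Finset.sum_const, hcard, nsmul_eq_mul, mul_one, ← hγ] at hv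
  have hmean : ∫ x : ι → ℝ, (∑ i ∈ Finset.range n, x (e i)) ∂γ = 0 := by
    rw [integral_finsetSum _ fun i _ => (memLp_eval_pi_gaussianReal (e i)).integrable one_le_two]
    refine Finset.sum_eq_zero fun i _ => ?_
    rw [integral_comp_eval (μ := fun _ : ι => gaussianReal 0 1) (f := fun z : ℝ => z)
      (by fun_prop)]
    exact integral_id_gaussianReal
  rw [variance_of_integral_eq_zero] at hv
  · rw [← hv]
    refine integral_congr_ae (.of_forall fun x => ?_)
    simp only [hsum, Finset.sum_apply]
  · exact Finset.aemeasurable_sum _ fun j _ => by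
      split_ifs
      · exact (measurable_pi_apply j).aemeasurable
      · exact aemeasurable_const
  · refine (integral_congr_ae (.of_forall fun x => ?_)).trans hmean
    simp only [Finset.sum_apply]
    exact (hsum x).symm

theorem measurePreserving_neg_pi_gaussianReal :
    MeasurePreserving (MeasurableEquiv.neg (ι → ℝ)) (Measure.pi fun _ => gaussianReal 0 1)
      (Measure.pi fun _ => gaussianReal 0 1) :=
  measurePreserving_pi (fun _ => gaussianReal 0 1) (fun _ => gaussianReal 0 1) (f := fun _ z => -z)
    fun _ => ⟨measurable_neg, by simpa using gaussianReal_map_neg (μ := 0) (v := 1)⟩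

theorem integral_sq_posPart_sum_pi_gaussianReal {n : ℕ} {e : ℕ → ι} (he : InjOn e (Iio n)) :
    ∫ x : ι → ℝ, max (∑ i ∈ Finset.range n, x (e i)) 0 ^ 2
      ∂(Measure.pi fun _ => gaussianReal 0 1) = n / 2 := by
  set γ : Measure (ι → ℝ) := Measure.pi fun _ => gaussianReal 0 1 with hγ
  have hL : MemLp (fun x : ι → ℝ => ∑ i ∈ Finset.range n, x (e i)) 2 γ :=
    memLp_finsetSum _ fun i _ => memLp_eval_pi_gaussianReal (e i)
  have hneg : ∫ x : ι → ℝ, max (-∑ i ∈ Finset.range n, x (e i)) 0 ^ 2 ∂γ =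
      ∫ x : ι → ℝ, max (∑ i ∈ Finset.range n, x (e i)) 0 ^ 2 ∂γ := by
    rw [← measurePreserving_neg_pi_gaussianReal.integral_comp']
    simp [hγ]
  have i1 : Integrable (fun x : ι → ℝ => max (∑ i ∈ Finset.range n, x (e i)) 0 ^ 2) γ :=
    hL.pos_part.integrable_sq
  have i2 : Integrable (fun x : ι → ℝ => max (-∑ i ∈ Finset.range n, x (e i)) 0 ^ 2) γ :=
    hL.neg.pos_part.integrable_sq
  have hadd := integral_add i1 i2
  have e1 : ∀ x : ι → ℝ, max (∑ i ∈ Finset.range n, x (e i)) 0 ^ 2 +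
      max (-∑ i ∈ Finset.range n, x (e i)) 0 ^ 2 = (∑ i ∈ Finset.range n, x (e i)) ^ 2 := by
    intro x
    rcases le_total 0 (∑ i ∈ Finset.range n, x (e i)) with h | h
    · rw [max_eq_left h, max_eq_right (neg_nonpos.2 h)]; ring
    · rw [max_eq_right h, max_eq_left (neg_nonneg.2 h)]; ring
  simp only [e1] at hadd
  rw [integral_sq_sum_pi_gaussianReal he, hneg] at hadd
  linarith

/-- By Fubini, Spitzer's identity can be used at each level a. Integrating (S_k - ka)⁺ over a gives
(S_k⁺)²/(2k), of mean 1/4; Spitzer's weight 1/k then produces the harmonic sum. -/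
theorem lintegral_antitoneExcess {n : ℕ} {e : ℕ → ι} (he : InjOn e (Iio n)) :
    ∫⁻ x : ι → ℝ, antitoneExcess n (fun i => x (e i)) ∂(Measure.pi fun _ => gaussianReal 0 1) =
      ENNReal.ofReal (harmonic n / 4) := by
  set γ : Measure (ι → ℝ) := Measure.pi fun _ => gaussianReal 0 1 with hγ
  have hm : ∀ k : ℕ, Measurable fun p : (ι → ℝ) × ℝ =>
      ENNReal.ofReal ((∑ i ∈ Finset.range (k + 1), p.1 (e i)) - (k + 1 : ℝ) * p.2) := by
    intro k; fun_prop
  have hm' : ∀ k : ℕ, Measurable fun p : ℝ × (ι → ℝ) =>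
      ENNReal.ofReal ((∑ i ∈ Finset.range (k + 1), p.2 (e i)) - (k + 1 : ℝ) * p.1) := by
    intro k; fun_prop
  have hM : Measurable fun p : (ι → ℝ) × ℝ =>
      ENNReal.ofReal (maxPartialSum n fun i => p.1 (e i) - p.2) :=
    ENNReal.measurable_ofReal.comp (measurable_maxPartialSum n fun i => by fun_prop)
  have hspitzer : ∀ a : ℝ, ∫⁻ x, ENNReal.ofReal (maxPartialSum n fun i => x (e i) - a) ∂γ =
      ∑ k ∈ Finset.range n, ENNReal.ofReal (1 / (k + 1)) *
        ∫⁻ x, ENNReal.ofReal ((∑ i ∈ Finset.range (k + 1), x (e i)) - (k + 1 : ℝ) * a) ∂γ := by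
    intro a
    have hφ : Integrable (fun z : ℝ => z - a) (gaussianReal 0 1) :=
      ((memLp_id_gaussianReal 1).integrable le_rfl).sub (integrable_const a)
    have hφm : Measurable fun z : ℝ => z - a := by fun_prop
    rw [← ofReal_integral_eq_lintegral_ofReal (integrable_maxPartialSum hφ hφm n e)
      (.of_forall fun x => maxPartialSum_nonneg _ _), integral_maxPartialSum hφ hφm he,
      ENNReal.ofReal_sum_of_nonneg fun k _ => by
        refine div_nonneg (integral_nonneg fun x => le_max_right _ _) (by positivity)]
    refine Finset.sum_congr rfl fun k _ => ?_
    rw [div_eq_inv_mul, ENNReal.ofReal_mul (by positivity), one_div,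
      ofReal_integral_eq_lintegral_ofReal]
    · congr 1
      refine lintegral_congr fun x => ?_
      rw [Finset.sum_sub_distrib]
      simp
    · exact Integrable.pos_part (integrable_finsetSum _ fun i _ =>
        integrable_comp_eval_pi hφ (e i))
    · exact .of_forall fun x => le_max_right _ _
  simp only [antitoneExcess]
  rw [lintegral_lintegral_swap hM.aemeasurable]
  simp only [hspitzer]
  rw [lintegral_finsetSum _ fun k _ => (hm' k).lintegral_prod_right'.const_mul _]
  have hk : ∀ k ∈ Finset.range n, ∫⁻ a in Ioi (0 : ℝ), ENNReal.ofReal (1 / (k + 1)) *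
      ∫⁻ x, ENNReal.ofReal ((∑ i ∈ Finset.range (k + 1), x (e i)) - (k + 1 : ℝ) * a) ∂γ =
      ENNReal.ofReal ((k + 1 : ℝ)⁻¹ / 4) := by
    intro k hk
    rw [lintegral_const_mul _ (hm' k).lintegral_prod_right',
      lintegral_lintegral_swap (hm' k).aemeasurable]
    have hk0 : (0 : ℝ) < k + 1 := by positivity
    simp only [lintegral_Ioi_ofReal_sub_mul _ hk0]
    have hL : MemLp (fun x : ι → ℝ => ∑ i ∈ Finset.range (k + 1), x (e i)) 2 γ :=
      memLp_finsetSum _ fun i _ => memLp_eval_pi_gaussianReal (e i)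
    rw [← ofReal_integral_eq_lintegral_ofReal (hL.pos_part.integrable_sq.div_const _)
      (.of_forall fun x => by positivity), integral_div, integral_sq_posPart_sum_pi_gaussianReal
        (he.mono (Iio_subset_Iio (Finset.mem_range.1 hk))), ← ENNReal.ofReal_mul (by positivity)]
    congr 1
    push_cast
    field_simp
    ring
  rw [Finset.sum_congr rfl hk, ← ENNReal.ofReal_sum_of_nonneg fun k _ => by positivity,
    ← Finset.sum_div, harmonic]
  push_cast
  rfl

theorem lintegral_antitoneExcess_neg {n : ℕ} {e : ℕ → ι} (he : InjOn e (Iio n)) :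
    ∫⁻ x : ι → ℝ, antitoneExcess n (fun i => -x (e i)) ∂(Measure.pi fun _ => gaussianReal 0 1) =
      ENNReal.ofReal (harmonic n / 4) := by
  rw [← lintegral_antitoneExcess he,
    ← (measurePreserving_neg_pi_gaussianReal (ι := ι)).lintegral_comp_emb
      (MeasurableEquiv.measurableEmbedding _)]
  simp

end Gaussian

/-! ### Monotone sequences on a finite set of indices. -/

/-- A finite set of indices can be enumerated increasingly by an initial segment of `ℕ`. -/
theorem exists_strictMonoOn_enumeration {ι : Type*} [LinearOrder ι] {A : Finset ι}
    (hA : A.Nonempty) :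
    ∃ e : ℕ → ι, StrictMonoOn e (Iio A.card) ∧ (Finset.range A.card).image e = A := by
  classical
  have hpos : 0 < A.card := hA.card_pos
  have hlt : ∀ i, min i (A.card - 1) < A.card := fun i => by omega
  refine ⟨fun i => A.orderEmbOfFin rfl ⟨min i (A.card - 1), hlt i⟩, ?_, ?_⟩
  · intro i hi j hj hij
    simp only [mem_Iio] at hi hj
    refine (A.orderEmbOfFin rfl).strictMono ?_
    rw [Fin.mk_lt_mk]
    omega
  · ext a
    simp only [Finset.mem_image, Finset.mem_range]
    constructor
    · rintro ⟨i, -, rfl⟩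
      exact Finset.orderEmbOfFin_mem _ _ _
    · intro ha
      have : a ∈ range (A.orderEmbOfFin rfl) := by rwa [Finset.range_orderEmbOfFin]
      obtain ⟨i, rfl⟩ := this
      refine ⟨i, i.2, ?_⟩
      congr 1
      ext
      have := i.2
      simp only
      omega

theorem harmonic_cast_nonneg (n : ℕ) : (0 : ℝ) ≤ harmonic n := by
  have : 0 ≤ harmonic n := Finset.sum_nonneg fun _ _ => by positivity
  exact_mod_cast this

section Piece

variable {ι : Type*} [Fintype ι] [LinearOrder ι]

/-- `D` is a measurable majorant of the conjugate over one piece. Each sign of v contributes mean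
H/4. -/
theorem exists_bound_of_antitoneOn (A : Finset ι) :
    ∃ D : (ι → ℝ) → ℝ≥0∞, Measurable D ∧
      ∫⁻ x, D x ∂(Measure.pi fun _ => gaussianReal 0 1) = ENNReal.ofReal (harmonic A.card / 2) ∧
      ∀ x v : ι → ℝ, AntitoneOn v A →
        ENNReal.ofReal (∑ i ∈ A, (x i * v i - v i ^ 2 / 2)) ≤ D x := by
  rcases A.eq_empty_or_nonempty with rfl | hA
  · exact ⟨0, measurable_const, by simp, by simp⟩
  obtain ⟨e, he, heA⟩ := exists_strictMonoOn_enumeration hA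
  have hinj : InjOn e (Iio A.card) := he.injOn
  have hinj' : InjOn (fun i => e (A.card - 1 - i)) (Iio A.card) := by
    intro i hi j hj hij
    simp only [mem_Iio] at hi hj
    have := hinj (show A.card - 1 - i < A.card by omega) (show A.card - 1 - j < A.card by omega) hij
    omega
  refine ⟨fun x => antitoneExcess A.card (fun i => x (e i)) +
    antitoneExcess A.card fun i => -x (e (A.card - 1 - i)), ?_, ?_, ?_⟩
  · exact (measurable_antitoneExcess _ fun i => by fun_prop).add
      (measurable_antitoneExcess _ fun i => by fun_prop)
  · rw [lintegral_add_left (measurable_antitoneExcess _ fun i => by fun_prop),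
      lintegral_antitoneExcess hinj, lintegral_antitoneExcess_neg hinj',
      ← ENNReal.ofReal_add (div_nonneg (harmonic_cast_nonneg _) (by norm_num))
        (div_nonneg (harmonic_cast_nonneg _) (by norm_num))]
    congr 1
    ring
  · intro x v hv
    have hanti : AntitoneOn (fun i => v (e i)) (Iio A.card) := by
      have hmem : ∀ i ∈ Iio A.card, e i ∈ (A : Set ι) := by
        intro i hi
        have : e i ∈ (Finset.range A.card).image e :=
          Finset.mem_image_of_mem _ (Finset.mem_range.2 hi)
        rwa [heA] at this
      exact fun i hi j hj hij => hv (hmem i hi) (hmem j hj) (he.monotoneOn hi hj hij)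
    have h := ofReal_sum_le_antitoneExcess_add hanti fun i => x (e i)
    rwa [← Finset.sum_image (g := e) (f := fun j => x j * v j - v j ^ 2 / 2)
      (by simpa using hinj), heA] at h

theorem exists_bound_of_monotoneOn (A : Finset ι) :
    ∃ D : (ι → ℝ) → ℝ≥0∞, Measurable D ∧
      ∫⁻ x, D x ∂(Measure.pi fun _ => gaussianReal 0 1) = ENNReal.ofReal (harmonic A.card / 2) ∧
      ∀ x v : ι → ℝ, MonotoneOn v A →
        ENNReal.ofReal (∑ i ∈ A, (x i * v i - v i ^ 2 / 2)) ≤ D x := by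
  obtain ⟨D, hD, hint, hle⟩ := exists_bound_of_antitoneOn A
  refine ⟨fun x => D (-x), hD.comp measurable_neg, ?_, fun x v hv => ?_⟩
  · rw [← hint]
    exact (measurePreserving_neg_pi_gaussianReal (ι := ι)).lintegral_comp_emb
      (MeasurableEquiv.measurableEmbedding _) D
  · simpa using hle (-x) (-v) hv.neg

end Piece

/-! ### Gaussian support functions of cones. -/

section SupportFunction

variable {ι : Type*} [Fintype ι]

/-- The support function of the part of `C` that lies in the Euclidean unit ball. -/
noncomputable def unitSupport (C : Set (ι → ℝ)) (x : ι → ℝ) : ℝ :=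
  sSup ((fun v : ι → ℝ => ∑ i, x i * v i) '' {v | v ∈ C ∧ ∑ i, v i ^ 2 ≤ 1})

variable {C : Set (ι → ℝ)}

theorem sum_mul_le_sqrt_of_sum_sq_le_one (x : ι → ℝ) {v : ι → ℝ} (hv : ∑ i, v i ^ 2 ≤ 1) :
    ∑ i, x i * v i ≤ √(∑ i, x i ^ 2) := by
  refine (Real.sum_mul_le_sqrt_mul_sqrt _ x v).trans ?_
  exact mul_le_of_le_one_right (Real.sqrt_nonneg _) (Real.sqrt_le_one.2 hv)

theorem bddAbove_unitSupport (C : Set (ι → ℝ)) (x : ι → ℝ) :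
    BddAbove ((fun v : ι → ℝ => ∑ i, x i * v i) '' {v | v ∈ C ∧ ∑ i, v i ^ 2 ≤ 1}) := by
  refine ⟨√(∑ i, x i ^ 2), ?_⟩
  rintro _ ⟨v, hv, rfl⟩
  exact sum_mul_le_sqrt_of_sum_sq_le_one x hv.2

theorem le_unitSupport (x : ι → ℝ) {v : ι → ℝ} (hv : v ∈ C) (hv' : ∑ i, v i ^ 2 ≤ 1) :
    ∑ i, x i * v i ≤ unitSupport C x :=
  le_csSup (bddAbove_unitSupport C x) ⟨v, ⟨hv, hv'⟩, rfl⟩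

theorem unitSupport_le (h0 : (0 : ι → ℝ) ∈ C) (x : ι → ℝ) {b : ℝ}
    (h : ∀ v ∈ C, ∑ i, v i ^ 2 ≤ 1 → ∑ i, x i * v i ≤ b) : unitSupport C x ≤ b := by
  refine csSup_le ⟨_, 0, ⟨h0, by simp⟩, rfl⟩ ?_
  rintro _ ⟨v, hv, rfl⟩
  exact h v hv.1 hv.2

theorem unitSupport_nonneg (h0 : (0 : ι → ℝ) ∈ C) (x : ι → ℝ) : 0 ≤ unitSupport C x := by
  simpa using le_unitSupport x h0 (by simp)

theorem unitSupport_sub_le (h0 : (0 : ι → ℝ) ∈ C) (x y : ι → ℝ) :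
    unitSupport C x - unitSupport C y ≤ √(∑ i, (x i - y i) ^ 2) := by
  rw [sub_le_iff_le_add]
  refine unitSupport_le h0 x fun v hv hv' => ?_
  have h1 := sum_mul_le_sqrt_of_sum_sq_le_one (fun i => x i - y i) hv'
  have h2 := le_unitSupport y hv hv'
  simp only [sub_mul, Finset.sum_sub_distrib] at h1
  linarith

theorem continuous_unitSupport (h0 : (0 : ι → ℝ) ∈ C) : Continuous (unitSupport C) := by
  refine continuous_iff_continuousAt.2 fun y => tendsto_iff_dist_tendsto_zero.2 ?_
  have hlim : Filter.Tendsto (fun x : ι → ℝ => √(∑ i, (x i - y i) ^ 2)) (nhds y) (nhds 0) := by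
    have : Continuous fun x : ι → ℝ => √(∑ i, (x i - y i) ^ 2) := by fun_prop
    simpa using this.tendsto y
  refine squeeze_zero (fun _ => dist_nonneg) (fun x => ?_) hlim
  rw [Real.dist_eq, abs_le]
  have h := unitSupport_sub_le h0 y x
  have e : ∑ i, (y i - x i) ^ 2 = ∑ i, (x i - y i) ^ 2 :=
    Finset.sum_congr rfl fun i _ => by ring
  rw [e] at h
  exact ⟨by linarith, unitSupport_sub_le h0 x y⟩

/-- On a cone the conjugate of half the squared norm dominates half the squared support function.
The mean is then controlled by the root of the second moment. -/
theorem memLp_unitSupport_of_sq_le {D : (ι → ℝ) → ℝ≥0∞} {γ : Measure (ι → ℝ)}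
    [IsProbabilityMeasure γ] (h0 : (0 : ι → ℝ) ∈ C)
    (hC : ∀ v ∈ C, ∀ t : ℝ, 0 ≤ t → (fun i => t * v i) ∈ C)
    (hD : ∀ x, ∀ v ∈ C, ENNReal.ofReal (∑ i, (x i * v i - v i ^ 2 / 2)) ≤ D x) {δ : ℝ}
    (hδ : 0 ≤ δ) (hint : ∫⁻ x, D x ∂γ ≤ ENNReal.ofReal (δ / 2)) :
    Integrable (unitSupport C) γ ∧ ∫ x, unitSupport C x ∂γ ≤ √δ := by
  have key : ∀ x, ENNReal.ofReal (unitSupport C x ^ 2 / 2) ≤ D x := by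
    intro x
    rcases eq_or_ne (D x) ∞ with h | h
    · simp [h]
    refine ENNReal.ofReal_le_of_le_toReal ?_
    have : unitSupport C x ≤ √(2 * (D x).toReal) := by
      refine unitSupport_le h0 x fun v hv hv' => ?_
      set s := ∑ i, x i * v i with hs
      rcases le_total s 0 with hs0 | hs0
      · exact hs0.trans (Real.sqrt_nonneg _)
      refine Real.le_sqrt_of_sq_le ?_
      -- Scaling v by t = s maximizes ts - t²/2.
      have h1 := hD x _ (hC v hv s hs0)
      have h2 : s ^ 2 / 2 ≤ ∑ i, (x i * (s * v i) - (s * v i) ^ 2 / 2) := by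
        have e : ∑ i, (x i * (s * v i) - (s * v i) ^ 2 / 2) =
            s * s - s ^ 2 / 2 * ∑ i, v i ^ 2 := by
          conv_rhs => rw [hs, Finset.mul_sum, Finset.mul_sum, ← hs]
          rw [← Finset.sum_sub_distrib]
          exact Finset.sum_congr rfl fun i _ => by ring
        rw [e]
        nlinarith [sq_nonneg s]
      have h3 := (ENNReal.ofReal_le_iff_le_toReal h).1
        ((ENNReal.ofReal_le_ofReal h2).trans h1)
      linarith
    have h4 : unitSupport C x ^ 2 ≤ 2 * (D x).toReal := by
      rw [← Real.sq_sqrt (show 0 ≤ 2 * (D x).toReal by positivity)]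
      exact pow_le_pow_left₀ (unitSupport_nonneg h0 x) this 2
    linarith
  have hm : Measurable (unitSupport C) := (continuous_unitSupport h0).measurable
  have hfin : ∫⁻ x, ENNReal.ofReal (unitSupport C x ^ 2 / 2) ∂γ ≤ ENNReal.ofReal (δ / 2) :=
    (lintegral_mono key).trans hint
  have hi : Integrable (fun x => unitSupport C x ^ 2 / 2) γ := by
    refine ⟨by fun_prop, ?_⟩
    rw [hasFiniteIntegral_iff_ofReal (.of_forall fun x => by positivity)]
    exact hfin.trans_lt ENNReal.ofReal_lt_top
  have hi2 : Integrable (fun x => unitSupport C x ^ 2) γ := by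
    simpa using hi.mul_const 2
  have hL : MemLp (unitSupport C) 2 γ :=
    (memLp_two_iff_integrable_sq hm.aestronglyMeasurable).2 hi2
  have hsq : ∫ x, unitSupport C x ^ 2 ∂γ ≤ δ := by
    rw [← ofReal_integral_eq_lintegral_ofReal hi (.of_forall fun x => by positivity),
      ENNReal.ofReal_le_ofReal_iff (by positivity), integral_div] at hfin
    linarith
  refine ⟨hL.integrable one_le_two, Real.le_sqrt_of_sq_le ?_⟩
  have hvar := variance_nonneg (unitSupport C) γ
  rw [variance_eq_sub hL] at hvar
  have : ∫ x, (unitSupport C ^ 2) x ∂γ = ∫ x, unitSupport C x ^ 2 ∂γ := rfl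
  linarith

theorem measure_exists_lt_sum_mul_le {n : ℕ} {C : Set (Fin n → ℝ)} (h0 : (0 : Fin n → ℝ) ∈ C)
    (hC : ∀ v ∈ C, ∀ t : ℝ, 0 ≤ t → (fun i => t * v i) ∈ C)
    (hi : Integrable (unitSupport C) (Measure.pi fun _ => gaussianReal 0 1)) {m r : ℝ}
    (hm : ∫ x, unitSupport C x ∂(Measure.pi fun _ => gaussianReal 0 1) ≤ m) (hr : 0 ≤ r) :
    (Measure.pi fun _ => gaussianReal 0 1)
      {x | ∃ v ∈ C, (m + r) * √(∑ i, v i ^ 2) < ∑ i, x i * v i} ≤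
      ENNReal.ofReal (Real.exp (-(r ^ 2 / 2))) := by
  refine le_trans (measure_mono ?_) (measure_pi_gaussianReal_lipschitz_ge_le
    (continuous_unitSupport h0).measurable (unitSupport_sub_le h0) hi hm hr)
  rintro x ⟨v, hv, hlt⟩
  set R := √(∑ i, v i ^ 2) with hR
  have hR2 : R ^ 2 = ∑ i, v i ^ 2 := Real.sq_sqrt (Finset.sum_nonneg fun i _ => sq_nonneg _)
  -- The zero vector cannot violate the strict bound; any other violator is normalized to a unit
  -- vector.
  rcases (show 0 ≤ R from Real.sqrt_nonneg _).eq_or_lt with h | h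
  · have hz : ∀ i, v i = 0 := by
      rw [← h] at hR2
      intro i
      have := (Finset.sum_eq_zero_iff_of_nonneg fun i _ => sq_nonneg (v i)).1
        (by rw [← hR2]; norm_num : ∑ i, v i ^ 2 = 0) i (Finset.mem_univ i)
      exact pow_eq_zero_iff two_ne_zero |>.1 this
    rw [← h] at hlt
    simp [hz] at hlt
  · have h1 := le_unitSupport x (hC v hv R⁻¹ (by positivity)) (by
      simp only [mul_pow]
      rw [← Finset.mul_sum, ← hR2]
      rw [← mul_pow, inv_mul_cancel₀ h.ne', one_pow])
    have e : ∑ i, x i * (R⁻¹ * v i) = R⁻¹ * ∑ i, x i * v i := by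
      rw [Finset.mul_sum]
      exact Finset.sum_congr rfl fun i _ => by ring
    rw [e] at h1
    refine le_trans (le_of_lt ?_) h1
    rw [inv_mul_eq_div, lt_div_iff₀ h]
    exact hlt

end SupportFunction

/-! ### Sums of harmonic numbers. -/

/-- Jensen's inequality for the sum of the harmonic numbers of a composition of `n` with at most `q`
nonzero summands. -/
theorem sum_harmonic_le {κ : Type*} (s : Finset κ) (a : κ → ℕ) {n q : ℕ}
    (hsum : ∑ k ∈ s, a k = n) (hq : 1 ≤ q) (hqn : q ≤ n)
    (hcard : (s.filter fun k => a k ≠ 0).card ≤ q) :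
    ∑ k ∈ s, (harmonic (a k) : ℝ) ≤ q * Real.log (Real.exp 1 * n / q) := by
  have hq0 : (0 : ℝ) < q := by exact_mod_cast hq
  have hn0 : (0 : ℝ) < n := by exact_mod_cast lt_of_lt_of_le hq hqn
  have hlog : 0 ≤ Real.log (n / q) :=
    Real.log_nonneg ((one_le_div hq0).2 (by exact_mod_cast hqn))
  have e : Real.log (Real.exp 1 * n / q) = 1 + Real.log (n / q) := by
    rw [mul_div_assoc, Real.log_mul (Real.exp_pos 1).ne' (by positivity), Real.log_exp]
  -- The tangent to 1 + log at the balanced length n / q; empty pieces contribute nothing.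
  have hk : ∀ k, (harmonic (a k) : ℝ) ≤
      a k * (q / n) + (if a k ≠ 0 then Real.log (n / q) else 0) := by
    intro k
    rcases Nat.eq_zero_or_pos (a k) with h | h
    · simp [h]
    · have ha : (0 : ℝ) < a k := by exact_mod_cast h
      have h1 := harmonic_le_one_add_log (a k)
      have h2 := Real.log_le_sub_one_of_pos (show (0 : ℝ) < a k * (q / n) by positivity)
      rw [Real.log_mul ha.ne' (by positivity), ← inv_div, Real.log_inv, inv_div] at h2
      simp only [ne_eq, h.ne', not_false_eq_true, if_true]
      linarith
  calc ∑ k ∈ s, (harmonic (a k) : ℝ)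
      ≤ ∑ k ∈ s, (a k * ((q : ℝ) / n) + (if a k ≠ 0 then Real.log (n / q) else 0)) :=
        Finset.sum_le_sum fun k _ => hk k
    _ = q + (s.filter fun k => a k ≠ 0).card * Real.log (n / q) := by
        rw [Finset.sum_add_distrib, ← Finset.sum_mul, ← Nat.cast_sum, hsum, ← Finset.sum_filter,
          Finset.sum_const, nsmul_eq_mul]
        congr 1
        field_simp
    _ ≤ q + q * Real.log (n / q) := by gcongr
    _ = _ := by rw [e]; ring

/-! ### The norm of a Gaussian vector. -/

theorem lintegral_pi_gaussianReal_eq {n : ℕ} {f : (Fin n → ℝ) → ℝ≥0∞} (hf : Measurable f) :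
    ∫⁻ x, f x ∂(Measure.pi fun _ => gaussianReal 0 1) =
      ∫⁻ x, (∏ i, gaussianPDF 0 1 (x i)) * f x := by
  have hp : Measurable (gaussianPDF 0 1) := measurable_gaussianPDF 0 1
  induction n with
  | zero =>
    rw [volume_pi, Measure.pi_of_empty _ 0, Measure.pi_of_empty _ 0]
    simp
  | succ n ih =>
    have hcons := measurable_comp_finCons hf
    have hprod : Measurable fun x : Fin (n + 1) → ℝ => ∏ i, gaussianPDF 0 1 (x i) :=
      Finset.measurable_prod _ fun i _ => hp.comp (measurable_pi_apply i)
    have hprod' : Measurable fun x : Fin n → ℝ => ∏ i, gaussianPDF 0 1 (x i) :=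
      Finset.measurable_prod _ fun i _ => hp.comp (measurable_pi_apply i)
    rw [volume_pi, lintegral_pi_fin_succ hf, lintegral_pi_fin_succ (ν := volume)
      (f := fun x => (∏ i, gaussianPDF 0 1 (x i)) * f x) (hprod.mul hf),
      gaussianReal_of_var_ne_zero 0 one_ne_zero,
      lintegral_withDensity_eq_lintegral_mul _ hp
        (by rw [← gaussianReal_of_var_ne_zero 0 one_ne_zero]; exact hcons.lintegral_prod_right')]
    refine lintegral_congr fun a => ?_
    have hc : Measurable fun x : Fin n → ℝ => f (Fin.cons a x) := hcons.comp measurable_prodMk_left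
    rw [Pi.mul_apply, ← gaussianReal_of_var_ne_zero 0 one_ne_zero, ih hc, volume_pi,
      ← lintegral_const_mul (f := fun x => (∏ i, gaussianPDF 0 1 (x i)) * f (Fin.cons a x)) _
        (hprod'.mul hc)]
    refine lintegral_congr fun x => ?_
    rw [Fin.prod_univ_succ]
    simp only [Fin.cons_zero, Fin.cons_succ, mul_assoc]

theorem prod_gaussianPDF {n : ℕ} (x : Fin n → ℝ) :
    ∏ i, gaussianPDF 0 1 (x i) =
      ENNReal.ofReal ((√(2 * Real.pi))⁻¹ ^ n * Real.exp (-(√(∑ i, x i ^ 2) ^ 2 / 2))) := by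
  simp only [gaussianPDF]
  rw [← ENNReal.ofReal_prod_of_nonneg fun i _ => gaussianPDFReal_nonneg _ _ _]
  simp only [gaussianPDFReal]
  rw [Finset.prod_mul_distrib, ← Real.exp_sum,
    Real.sq_sqrt (Finset.sum_nonneg fun i _ => sq_nonneg (x i))]
  simp [Finset.sum_div, neg_div]

/-- The law of the norm of a standard Gaussian vector in `ℝⁿ` has a density proportional to
`y ^ (n - 1) * exp (- y ^ 2 / 2)`. -/
theorem exists_measureReal_norm_lt_eq {n : ℕ} (hn : 1 ≤ n) :
    ∃ K : ℝ, 0 ≤ K ∧ ∀ R : ℝ,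
      (Measure.pi fun _ => gaussianReal 0 1).real {x : Fin n → ℝ | R < √(∑ i, x i ^ 2)} =
        K * ∫ y in Ioi (0 : ℝ),
          (Ioi R).indicator (fun y => y ^ (n - 1) * Real.exp (-(y ^ 2 / 2))) y := by
  have : Nonempty (Fin n) := ⟨⟨0, hn⟩⟩
  refine ⟨n * (volume : Measure (EuclideanSpace ℝ (Fin n))).real (Metric.ball 0 1) *
    (√(2 * Real.pi))⁻¹ ^ n, by positivity, fun R => ?_⟩
  set c : ℝ := (√(2 * Real.pi))⁻¹ ^ n with hc
  set g : ℝ → ℝ := (Ioi R).indicator fun y => c * Real.exp (-(y ^ 2 / 2)) with hg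
  have hg0 : ∀ y, 0 ≤ g y := fun y => indicator_nonneg (fun _ _ => by positivity) _
  have hgm : Measurable g := by
    refine Measurable.indicator ?_ measurableSet_Ioi
    fun_prop
  have hS : MeasurableSet {x : Fin n → ℝ | R < √(∑ i, x i ^ 2)} :=
    measurableSet_lt measurable_const (by fun_prop)
  have h1 : (Measure.pi fun _ => gaussianReal 0 1) {x : Fin n → ℝ | R < √(∑ i, x i ^ 2)} =
      ∫⁻ x : EuclideanSpace ℝ (Fin n), ENNReal.ofReal (g ‖x‖) := by
    rw [← lintegral_indicator_one hS, lintegral_pi_gaussianReal_eq (measurable_one.indicator hS),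
      ← (EuclideanSpace.volume_preserving_symm_measurableEquiv_toLp (Fin n)).lintegral_comp_emb
        (MeasurableEquiv.measurableEmbedding _)]
    refine lintegral_congr fun x => ?_
    rw [prod_gaussianPDF, EuclideanSpace.norm_eq]
    simp only [Real.norm_eq_abs, sq_abs, hg]
    by_cases hx : R < √(∑ i, x i ^ 2)
    · rw [indicator_of_mem (show _ ∈ Ioi R from hx), indicator_of_mem (by exact hx)]
      simp [hc]
    · rw [indicator_of_notMem (show _ ∉ Ioi R from hx), indicator_of_notMem (by exact hx)]
      simp
  have h2 := integral_fun_norm_addHaar (volume : Measure (EuclideanSpace ℝ (Fin n))) g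
  rw [integral_eq_lintegral_of_nonneg_ae (.of_forall fun x => hg0 _)
    (hgm.comp measurable_norm).aestronglyMeasurable, ← h1, finrank_euclideanSpace_fin] at h2
  have h3 : ∫ y in Ioi (0 : ℝ), y ^ (n - 1) • g y = c * ∫ y in Ioi (0 : ℝ),
      (Ioi R).indicator (fun y => y ^ (n - 1) * Real.exp (-(y ^ 2 / 2))) y := by
    rw [← integral_const_mul]
    refine integral_congr_ae (.of_forall fun y => ?_)
    simp only [smul_eq_mul, hg]
    by_cases hy : y ∈ Ioi R
    · simp only [indicator_of_mem hy]; ring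
    · simp only [indicator_of_notMem hy]; ring
  rw [measureReal_def, h2, h3, nsmul_eq_mul, smul_eq_mul]
  ring

/-- Since n ≤ z², (1 + r/z)ⁿ ≤ exp(nr/z) ≤ exp(zr), which cancels the cross term of (z + r)²/2. -/
theorem pow_mul_exp_add_le {n : ℕ} {z r : ℝ} (hz : √n < z) (hr : 0 ≤ r) :
    (z + r) ^ n * Real.exp (-((z + r) ^ 2 / 2)) ≤
      Real.exp (-(r ^ 2 / 2)) * (z ^ n * Real.exp (-(z ^ 2 / 2))) := by
  have hz0 : 0 < z := (Real.sqrt_nonneg _).trans_lt hz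
  have hnz : (n : ℝ) ≤ z ^ 2 := by
    rw [← Real.sqrt_le_left hz0.le]
    exact hz.le
  have h1 : z + r ≤ z * Real.exp (r / z) := by
    have := Real.add_one_le_exp (r / z)
    calc z + r = z * (r / z + 1) := by field_simp; ring
      _ ≤ _ := by gcongr
  have h2 : (z + r) ^ n ≤ z ^ n * Real.exp (z * r) := by
    calc (z + r) ^ n ≤ (z * Real.exp (r / z)) ^ n := by gcongr
      _ = z ^ n * Real.exp (n * (r / z)) := by rw [mul_pow, ← Real.exp_nat_mul]
      _ ≤ z ^ n * Real.exp (z * r) := by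
        refine mul_le_mul_of_nonneg_left (Real.exp_le_exp.2 ?_) (by positivity)
        rw [mul_div_assoc', div_le_iff₀ hz0]
        nlinarith
  calc (z + r) ^ n * Real.exp (-((z + r) ^ 2 / 2))
      ≤ z ^ n * Real.exp (z * r) * Real.exp (-((z + r) ^ 2 / 2)) := by gcongr
    _ = _ := by
      rw [mul_assoc, ← Real.exp_add, mul_left_comm, ← Real.exp_add]
      congr 2
      ring

/-- The norm of a standard Gaussian vector in `ℝⁿ` exceeds `√(n - 1) + r` with probability at most
`exp (- r ^ 2 / 2)`. -/
theorem measure_sqrt_add_lt_norm_le {n : ℕ} (hn : 1 ≤ n) {r : ℝ} (hr : 0 ≤ r) :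
    (Measure.pi fun _ => gaussianReal 0 1)
      {x : Fin n → ℝ | √((n - 1 : ℕ) : ℝ) + r < √(∑ i, x i ^ 2)} ≤
      ENNReal.ofReal (Real.exp (-(r ^ 2 / 2))) := by
  obtain ⟨K, hK, hKR⟩ := exists_measureReal_norm_lt_eq hn
  set h : ℝ → ℝ := fun y => y ^ (n - 1) * Real.exp (-(y ^ 2 / 2)) with hh
  set R := √((n - 1 : ℕ) : ℝ) with hR
  have hR0 : 0 ≤ R := Real.sqrt_nonneg _
  -- The radius -1 makes the event certain, so `K` is determined by total mass 1.
  have htot : K * ∫ y in Ioi (0 : ℝ), h y = 1 := by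
    have h1 := hKR (-1)
    have h2 : {x : Fin n → ℝ | -1 < √(∑ i, x i ^ 2)} = univ :=
      eq_univ_of_forall fun x => lt_of_lt_of_le (by norm_num) (Real.sqrt_nonneg _)
    rw [h2, probReal_univ] at h1
    rw [h1]
    congr 1
    refine setIntegral_congr_fun measurableSet_Ioi fun y hy => ?_
    have hy' : y ∈ Ioi (-1 : ℝ) := lt_trans (by norm_num) (mem_Ioi.1 hy)
    exact (indicator_of_mem hy' h).symm
  -- Otherwise the integral would be 0 by convention, contradicting `htot`.
  have hint : IntegrableOn h (Ioi 0) := by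
    by_contra hni
    rw [integral_undef hni] at htot
    norm_num at htot
  have hind : ∀ a : ℝ, 0 ≤ a → ∫ y in Ioi (0 : ℝ), (Ioi a).indicator h y = ∫ y in Ioi a, h y := by
    intro a ha
    rw [setIntegral_indicator measurableSet_Ioi, Ioi_inter_Ioi, max_eq_right ha]
  have hsub : ∀ a : ℝ, 0 ≤ a → IntegrableOn h (Ioi a) := fun a ha =>
    hint.mono_set (Ioi_subset_Ioi ha)
  have hshift : ∫ y in Ioi (R + r), h y = ∫ z in Ioi R, h (z + r) := by
    have := (measurePreserving_add_right volume r).setIntegral_preimage_emb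
      (measurableEmbedding_addRight r) h (Ioi (R + r))
    simpa using this.symm
  -- The tail is shifted back by r and compared pointwise beyond R = √(n - 1), the mode of the
  -- radial density.
  have hle : ∫ y in Ioi (R + r), h y ≤ Real.exp (-(r ^ 2 / 2)) * ∫ y in Ioi (0 : ℝ), h y := by
    rw [hshift]
    calc ∫ z in Ioi R, h (z + r) ≤ ∫ z in Ioi R, Real.exp (-(r ^ 2 / 2)) * h z := by
          refine setIntegral_mono_on ?_ ((hsub R hR0).const_mul _) measurableSet_Ioi
            fun z hz => pow_mul_exp_add_le hz hr
          have hm : Measurable fun z => h (z + r) := by fun_prop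
          refine Integrable.mono' ((hsub R hR0).const_mul (Real.exp (-(r ^ 2 / 2))))
            hm.aestronglyMeasurable ((ae_restrict_iff' measurableSet_Ioi).2 (.of_forall ?_))
          intro z hz
          have hz0 : 0 < z := hR0.trans_lt hz
          rw [Real.norm_of_nonneg (by simp only [hh]; positivity)]
          exact pow_mul_exp_add_le hz hr
      _ = Real.exp (-(r ^ 2 / 2)) * ∫ z in Ioi R, h z := integral_const_mul _ _
      _ ≤ _ := by
          refine mul_le_mul_of_nonneg_left ?_ (Real.exp_pos _).le
          refine setIntegral_mono_set hint ?_ (Ioi_subset_Ioi hR0).eventuallyLE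
          refine (ae_restrict_iff' measurableSet_Ioi).2 (.of_forall fun y hy => ?_)
          have : 0 < y := hy
          simp only [hh, Pi.zero_apply]
          positivity
  rw [← ENNReal.ofReal_toReal (measure_ne_top _ {x : Fin n → ℝ | R + r < √(∑ i, x i ^ 2)}),
    ← measureReal_def, hKR, hind _ (by positivity)]
  refine ENNReal.ofReal_le_ofReal ?_
  calc K * ∫ y in Ioi (R + r), h y
      ≤ K * (Real.exp (-(r ^ 2 / 2)) * ∫ y in Ioi (0 : ℝ), h y) := by gcongr
    _ = Real.exp (-(r ^ 2 / 2)) * (K * ∫ y in Ioi (0 : ℝ), h y) := by ring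
    _ = _ := by rw [htot, mul_one]

/-! ### The cone of a partition and a mode. -/

theorem Finpartition.sum_sum_parts {α M : Type*} [DecidableEq α] [AddCommMonoid M] {s : Finset α}
    (T : Finpartition s) (g : α → M) : ∑ A ∈ T.parts, ∑ i ∈ A, g i = ∑ i ∈ s, g i := by
  conv_rhs => rw [← T.biUnion_parts]
  exact (Finset.sum_biUnion T.disjoint).symm

section Cone

variable {n : ℕ}

/-- The cone of vectors that are non-increasing up to `m` and non-decreasing from `m` on within
each of the parts of `T`. It contains `v - u` if `v` is in `unimodalAt m` and `u` is constant on
the parts of `T`. -/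
def unimodalCone (T : Finpartition (Finset.univ : Finset (Fin n))) (m : Fin n) :
    Set (Fin n → ℝ) :=
  {v | ∀ A ∈ T.parts, AntitoneOn v {i | i ∈ A ∧ i ≤ m} ∧ MonotoneOn v {i | i ∈ A ∧ m ≤ i}}

variable (T : Finpartition (Finset.univ : Finset (Fin n))) (m : Fin n)

theorem zero_mem_unimodalCone : (0 : Fin n → ℝ) ∈ unimodalCone T m :=
  fun _ _ => ⟨fun _ _ _ _ _ => le_rfl, fun _ _ _ _ _ => le_rfl⟩

theorem mul_mem_unimodalCone {v : Fin n → ℝ} (hv : v ∈ unimodalCone T m) {t : ℝ} (ht : 0 ≤ t) :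
    (fun i => t * v i) ∈ unimodalCone T m :=
  fun A hA => ⟨fun _ hi _ hj hij => mul_le_mul_of_nonneg_left ((hv A hA).1 hi hj hij) ht,
    fun _ hi _ hj hij => mul_le_mul_of_nonneg_left ((hv A hA).2 hi hj hij) ht⟩

theorem sub_mem_unimodalCone {u v : EuclideanSpace ℝ (Fin n)} (hv : v ∈ unimodalAt m)
    (hu : ∀ A ∈ T.parts, ∀ a ∈ A, ∀ b ∈ A, u a = u b) :
    (fun i => v i - u i) ∈ unimodalCone T m := by
  refine fun A hA => ⟨fun i hi j hj hij => ?_, fun i hi j hj hij => ?_⟩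
  · have h1 : v j ≤ v i := hv.1 hi.2 hj.2 hij
    have h2 := hu A hA i hi.1 j hj.1
    simp only
    linarith
  · have h1 : v i ≤ v j := hv.2 hi.2 hj.2 hij
    have h2 := hu A hA i hi.1 j hj.1
    simp only
    linarith

/-- The part of `A` up to `m` or the part of `A` after `m`. -/
def splitPart (p : Finset (Fin n) × Bool) : Finset (Fin n) :=
  if p.2 then p.1.filter (· ≤ m) else p.1.filter fun i => ¬i ≤ m

theorem sum_splitPart {M : Type*} [AddCommMonoid M] (g : Fin n → M) :
    ∑ p ∈ T.parts ×ˢ Finset.univ, ∑ i ∈ splitPart m p, g i = ∑ i, g i := by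
  rw [Finset.sum_product, ← T.sum_sum_parts]
  refine Finset.sum_congr rfl fun A _ => ?_
  rw [Fintype.sum_bool]
  exact Finset.sum_filter_add_sum_filter_not A _ g

/-- A part with indices on both sides of the cut contains m, being an interval; only one part does.
-/
theorem card_filter_splitPart_le (hT : ∀ A ∈ T.parts, (A : Set (Fin n)).OrdConnected) :
    ((T.parts ×ˢ Finset.univ).filter fun p => (splitPart m p).card ≠ 0).card ≤
      T.parts.card + 1 := by
  obtain ⟨A₀, ⟨-, -⟩, huniq⟩ := T.existsUnique_mem (Finset.mem_univ m)
  have hle : ∀ A ∈ T.parts, (∑ b : Bool, if (splitPart m (A, b)).card ≠ 0 then 1 else 0) ≤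
      1 + if A = A₀ then 1 else 0 := by
    intro A hA
    rw [Fintype.sum_bool]
    by_cases h1 : (splitPart m (A, true)).card ≠ 0
    · by_cases h2 : (splitPart m (A, false)).card ≠ 0
      · obtain ⟨i, hi⟩ := Finset.card_ne_zero.1 h1
        obtain ⟨j, hj⟩ := Finset.card_ne_zero.1 h2
        simp only [splitPart, if_true, Finset.mem_filter, Bool.false_eq_true, if_false,
          not_le] at hi hj
        have hm : m ∈ A := (hT A hA).out hi.1 hj.1 ⟨hi.2, hj.2.le⟩
        simp [huniq A ⟨hA, hm⟩]
        split_ifs <;> omega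
      · rw [if_neg h2]
        split_ifs <;> omega
    · rw [if_neg h1]
      split_ifs <;> omega
  rw [Finset.card_filter, Finset.sum_product]
  refine (Finset.sum_le_sum hle).trans ?_
  rw [Finset.sum_add_distrib, Finset.sum_ite_eq']
  simp only [Finset.sum_const, smul_eq_mul, mul_one]
  split_ifs <;> omega

theorem integral_unitSupport_unimodalCone_le
    (hT : ∀ A ∈ T.parts, (A : Set (Fin n)).OrdConnected) (hcard : T.parts.card + 1 ≤ n) :
    Integrable (unitSupport (unimodalCone T m)) (Measure.pi fun _ => gaussianReal 0 1) ∧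
      ∫ x, unitSupport (unimodalCone T m) x ∂(Measure.pi fun _ => gaussianReal 0 1) ≤
        √(((T.parts.card : ℝ) + 1) * Real.log (Real.exp 1 * n / ((T.parts.card : ℝ) + 1))) := by
  have hex : ∀ p : Finset (Fin n) × Bool, ∃ D : (Fin n → ℝ) → ℝ≥0∞, Measurable D ∧
      ∫⁻ x, D x ∂(Measure.pi fun _ => gaussianReal 0 1) =
        ENNReal.ofReal (harmonic (splitPart m p).card / 2) ∧
      (p ∈ T.parts ×ˢ Finset.univ → ∀ x, ∀ v ∈ unimodalCone T m,
        ENNReal.ofReal (∑ i ∈ splitPart m p, (x i * v i - v i ^ 2 / 2)) ≤ D x) := by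
    rintro ⟨A, _ | _⟩
    · obtain ⟨D, hD, hint, hle⟩ := exists_bound_of_monotoneOn (splitPart m (A, false))
      refine ⟨D, hD, hint, fun hp x v hv => hle x v ?_⟩
      refine ((hv A (Finset.mem_product.1 hp).1).2).mono fun i hi => ?_
      simp only [splitPart, Bool.false_eq_true, if_false, Finset.coe_filter, mem_ofPred_eq,
        not_le] at hi
      exact ⟨hi.1, hi.2.le⟩
    · obtain ⟨D, hD, hint, hle⟩ := exists_bound_of_antitoneOn (splitPart m (A, true))
      refine ⟨D, hD, hint, fun hp x v hv => hle x v ?_⟩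
      refine ((hv A (Finset.mem_product.1 hp).1).1).mono fun i hi => ?_
      simpa only [splitPart, if_true, Finset.coe_filter] using hi
  choose D hD hint hle using hex
  have hsum := sum_splitPart T m fun _ => 1
  simp only [Finset.sum_const, smul_eq_mul, mul_one, Finset.card_univ, Fintype.card_fin] at hsum
  have hharm := sum_harmonic_le (T.parts ×ˢ Finset.univ) (fun p => (splitPart m p).card)
    (n := n) (q := T.parts.card + 1)
    hsum (by omega) hcard
    (card_filter_splitPart_le T m hT)
  push_cast at hharm
  refine memLp_unitSupport_of_sq_le (D := fun x => ∑ p ∈ T.parts ×ˢ Finset.univ, D p x)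
    (zero_mem_unimodalCone T m) (fun v hv t ht => mul_mem_unimodalCone T m hv ht) ?_
    (le_trans (Finset.sum_nonneg fun p _ => harmonic_cast_nonneg _) hharm) ?_
  · intro x v hv
    rw [← sum_splitPart T m fun i => x i * v i - v i ^ 2 / 2]
    refine (Finset.le_sum_of_subadditive ENNReal.ofReal ENNReal.ofReal_zero.le
      (fun _ _ => ENNReal.ofReal_add_le) _ _).trans ?_
    exact Finset.sum_le_sum fun p hp => hle p hp x v hv
  · rw [lintegral_finsetSum _ fun p _ => hD p, Finset.sum_congr rfl fun p _ => hint p,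
      ← ENNReal.ofReal_sum_of_nonneg fun p _ =>
        div_nonneg (harmonic_cast_nonneg _) (by norm_num), ← Finset.sum_div]
    exact ENNReal.ofReal_le_ofReal (by linarith)

/-- For n singleton parts the target lies strictly below n, so centring the norm at √n would be too
weak; √(n - 1) suffices. -/
theorem sub_one_le_mul_log {n : ℕ} (hn : 1 ≤ n) :
    ((n - 1 : ℕ) : ℝ) ≤ ((n : ℝ) + 1) * Real.log (Real.exp 1 * n / ((n : ℝ) + 1)) := by
  have hn0 : (0 : ℝ) < n := by exact_mod_cast hn
  have h := Real.log_le_sub_one_of_pos (show (0 : ℝ) < (n + 1) / n by positivity)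
  have e : Real.log (Real.exp 1 * n / ((n : ℝ) + 1)) = 1 - Real.log ((n + 1) / n) := by
    rw [mul_div_assoc, Real.log_mul (Real.exp_pos 1).ne' (by positivity), Real.log_exp,
      ← inv_div, Real.log_inv]
    ring
  rw [e, Nat.cast_sub hn, Nat.cast_one]
  have h2 : 1 - 1 / (n : ℝ) ≤ 1 - Real.log ((n + 1) / n) := by
    have : ((n : ℝ) + 1) / n - 1 = 1 / n := by field_simp; ring
    linarith
  refine le_trans ?_ (mul_le_mul_of_nonneg_left h2 (by positivity))
  have h3 : ((n : ℝ) + 1) * (1 - 1 / n) = n - 1 / n := by field_simp; ring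
  have h4 : 1 / (n : ℝ) ≤ 1 := by
    rw [div_le_one hn0]
    exact_mod_cast hn
  rw [h3]
  linarith

theorem measure_exists_unimodalCone_le (hT : ∀ A ∈ T.parts, (A : Set (Fin n)).OrdConnected)
    {r : ℝ} (hr : 0 ≤ r) :
    (Measure.pi fun _ => gaussianReal 0 1)
      {x | ∃ v ∈ unimodalCone T m,
        (√(((T.parts.card : ℝ) + 1) * Real.log (Real.exp 1 * n / ((T.parts.card : ℝ) + 1))) + r) *
          √(∑ i, v i ^ 2) < ∑ i, x i * v i} ≤ ENNReal.ofReal (Real.exp (-(r ^ 2 / 2))) := by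
  rcases Nat.lt_or_ge T.parts.card n with hcard | hcard
  · obtain ⟨hi, hle⟩ := integral_unitSupport_unimodalCone_le T m hT hcard
    exact measure_exists_lt_sum_mul_le (zero_mem_unimodalCone T m)
      (fun v hv t ht => mul_mem_unimodalCone T m hv ht) hi hle hr
  -- All parts are singletons and the cone imposes no constraint, so Cauchy–Schwarz reduces the
  -- event to a tail of the norm.
  · have hn : T.parts.card = n :=
      le_antisymm (by simpa using T.card_parts_le_card) hcard
    have hn1 : 1 ≤ n := Nat.succ_le_of_lt (lt_of_le_of_lt (Nat.zero_le _) m.2)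
    rw [hn]
    refine le_trans (measure_mono ?_) (measure_sqrt_add_lt_norm_le hn1 hr)
    rintro x ⟨v, -, hlt⟩
    have h1 := Real.sum_mul_le_sqrt_mul_sqrt Finset.univ x v
    have h2 := Real.sqrt_le_sqrt (sub_one_le_mul_log hn1)
    have h3 : 0 ≤ √(∑ i, v i ^ 2) := Real.sqrt_nonneg _
    have h4 := lt_of_mul_lt_mul_right (hlt.trans_le h1) h3
    exact lt_of_le_of_lt (by linarith) h4

end Cone

/-! ### Least squares and the oracle inequality. -/

theorem scaledNorm_eq_norm_div {n : ℕ} (u : EuclideanSpace ℝ (Fin n)) :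
    scaledNorm u = ‖u‖ / √n := by
  rw [scaledNorm, EuclideanSpace.norm_eq, Real.sqrt_mul (by positivity), one_div, Real.sqrt_inv,
    div_eq_inv_mul]
  simp

/-- The basic inequality for least squares: only the inner product of the noise with the
normalized difference of the estimator and the oracle enters. -/
theorem norm_sub_le_of_norm_le {E : Type*} [NormedAddCommGroup E] [InnerProductSpace ℝ E]
    {μ z u v : E} {q : ℝ} (hq : 0 ≤ q) (h : ‖μ + z - v‖ ≤ ‖μ + z - u‖)
    (hz : inner ℝ z (v - u) ≤ q * ‖v - u‖) : ‖v - μ‖ ≤ ‖u - μ‖ + 2 * q := by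
  have e : ∀ w : E, ‖μ + z - w‖ ^ 2 = ‖z‖ ^ 2 - 2 * inner ℝ z (w - μ) + ‖w - μ‖ ^ 2 := by
    intro w
    rw [← norm_sub_sq_real]
    congr 2
    abel
  have h1 : ‖μ + z - v‖ ^ 2 ≤ ‖μ + z - u‖ ^ 2 := by gcongr
  rw [e, e] at h1
  have h2 : inner ℝ z (v - μ) - inner ℝ z (u - μ) = inner ℝ z (v - u) := by
    rw [← inner_sub_right]
    congr 1
    abel
  have h3 : ‖v - u‖ ≤ ‖v - μ‖ + ‖u - μ‖ := by
    rw [← sub_sub_sub_cancel_right v u μ]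
    exact norm_sub_le _ _
  have h4 : q * ‖v - u‖ ≤ q * (‖v - μ‖ + ‖u - μ‖) := by gcongr
  by_contra hlt
  push Not at hlt
  have h5 := norm_nonneg (v - μ)
  have h6 := norm_nonneg (u - μ)
  nlinarith [mul_pos (show 0 < ‖v - μ‖ - ‖u - μ‖ - 2 * q by linarith)
    (show 0 < ‖v - μ‖ + ‖u - μ‖ by linarith)]

theorem multivariateGaussian_zero_sq_smul_one {n : ℕ} {σ : ℝ} (hσ : 0 ≤ σ) :
    multivariateGaussian 0 (σ ^ 2 • (1 : Matrix (Fin n) (Fin n) ℝ)) =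
      (Measure.pi fun _ => gaussianReal 0 1).map fun x : Fin n → ℝ => σ • WithLp.toLp 2 x := by
  open scoped MatrixOrder in
  have hsqrt : CFC.sqrt (σ ^ 2 • (1 : Matrix (Fin n) (Fin n) ℝ)) = σ • 1 :=
    CFC.sqrt_unique (by simp [smul_smul, sq]) (smul_nonneg hσ zero_le_one)
  rw [multivariateGaussian, hsqrt, ← map_pi_eq_stdGaussian, Measure.map_map (by fun_prop)
    (by fun_prop)]
  congr 1
  ext x i
  simp

theorem measure_exists_unimodalCone_lt_inner_le {n : ℕ} {σ : ℝ} (hσ : 0 < σ)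
    {Ω : Type*} [MeasurableSpace Ω] {P : Measure Ω} {ξ : Ω → EuclideanSpace ℝ (Fin n)}
    (hξ : HasLaw ξ (multivariateGaussian 0 (σ ^ 2 • (1 : Matrix (Fin n) (Fin n) ℝ))) P)
    (T : Finpartition (Finset.univ : Finset (Fin n)))
    (hT : ∀ A ∈ T.parts, (A : Set (Fin n)).OrdConnected) (m : Fin n) {r : ℝ} (hr : 0 ≤ r) :
    P {ω | ∃ w : EuclideanSpace ℝ (Fin n), (fun i => w i) ∈ unimodalCone T m ∧
      σ * (√(((T.parts.card : ℝ) + 1) *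
        Real.log (Real.exp 1 * n / ((T.parts.card : ℝ) + 1))) + r) * ‖w‖ < inner ℝ (ξ ω) w} ≤
      ENNReal.ofReal (Real.exp (-(r ^ 2 / 2))) := by
  refine le_trans ?_ (measure_exists_unimodalCone_le T m hT hr)
  set c := √(((T.parts.card : ℝ) + 1) *
    Real.log (Real.exp 1 * n / ((T.parts.card : ℝ) + 1))) + r with hc
  set B : Set (EuclideanSpace ℝ (Fin n)) := {z | ∃ w : EuclideanSpace ℝ (Fin n),
    (fun i => w i) ∈ unimodalCone T m ∧ σ * c * ‖w‖ < inner ℝ z w} with hB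
  -- An uncountable union of open half-spaces (or trivial open sets) is still open, hence
  -- measurable.
  have hBo : IsOpen B := by
    have : B = ⋃ w ∈ {w : EuclideanSpace ℝ (Fin n) | (fun i => w i) ∈ unimodalCone T m},
        {z | σ * c * ‖w‖ < inner ℝ z w} := by
      ext z
      simp [hB]
    rw [this]
    exact isOpen_biUnion fun w _ => isOpen_lt continuous_const (by fun_prop)
  calc P (ξ ⁻¹' B) ≤ P.map ξ B := Measure.le_map_apply hξ.aemeasurable B
    _ = (Measure.pi fun _ => gaussianReal 0 1)
        ((fun x : Fin n → ℝ => σ • WithLp.toLp 2 x) ⁻¹' B) := by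
      rw [hξ.map_eq, multivariateGaussian_zero_sq_smul_one hσ.le,
        Measure.map_apply (by fun_prop) hBo.measurableSet]
    _ ≤ _ := by
      refine measure_mono ?_
      rintro x ⟨w, hw, hlt⟩
      refine ⟨_, hw, ?_⟩
      rw [real_inner_smul_left, mul_assoc] at hlt
      have h := lt_of_mul_lt_mul_left hlt hσ.le
      rw [EuclideanSpace.norm_eq] at h
      simpa [PiLp.inner_apply, mul_comm] using h

theorem scaledNorm_sub_le_of_mem_leastSquares {n : ℕ} (hn : 1 ≤ n)
    {μ z u v : EuclideanSpace ℝ (Fin n)} {q : ℝ} (hq : 0 ≤ q) (hu : u ∈ unimodal n)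
    (hv : v ∈ leastSquares (unimodal n) (μ + z)) (hz : inner ℝ z (v - u) ≤ q * ‖v - u‖) :
    scaledNorm (v - μ) ≤ scaledNorm (u - μ) + 2 * q / √n := by
  have hn0 : (0 : ℝ) < √n := Real.sqrt_pos.2 (by exact_mod_cast hn)
  have h : scaledNorm (μ + z - v) ^ 2 ≤ scaledNorm (μ + z - u) ^ 2 := hv.2 hu
  rw [scaledNorm_eq_norm_div, scaledNorm_eq_norm_div] at h
  have h' := (div_le_div_iff_of_pos_right hn0).1
    ((sq_le_sq₀ (by positivity) (by positivity)).1 h)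
  rw [scaledNorm_eq_norm_div, scaledNorm_eq_norm_div, ← add_div]
  gcongr
  exact norm_sub_le_of_norm_le hq h' hz

/-- The mode of the estimator is random, hence the union bound over m. The bad events involve only
`T`, so all u constant on its parts are handled at once. -/
theorem measure_oracle_inequality_of_finpartition {n : ℕ} (hn : 1 ≤ n) {σ : ℝ} (hσ : 0 < σ)
    (μ : EuclideanSpace ℝ (Fin n)) {Ω : Type*} [MeasurableSpace Ω] {P : Measure Ω}
    [IsProbabilityMeasure P] {ξ : Ω → EuclideanSpace ℝ (Fin n)}
    (hξ : HasLaw ξ (multivariateGaussian 0 (σ ^ 2 • (1 : Matrix (Fin n) (Fin n) ℝ))) P)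
    {x : ℝ} (hx : 0 < x) (T : Finpartition (Finset.univ : Finset (Fin n)))
    (hT : ∀ A ∈ T.parts, (A : Set (Fin n)).OrdConnected) :
    ENNReal.ofReal (1 - Real.exp (-x)) ≤
      P {ω | ∀ v ∈ leastSquares (unimodal n) (μ + ξ ω), ∀ u ∈ unimodal n,
        (∀ A ∈ T.parts, ∀ a ∈ A, ∀ b ∈ A, u a = u b) →
        scaledNorm (v - μ) ≤ scaledNorm (u - μ) + 2 * σ / √n *
          (√(((T.parts.card : ℝ) + 1) * Real.log (Real.exp 1 * n / ((T.parts.card : ℝ) + 1))) +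
            √(2 * (x + Real.log n)))} := by
  have hn0 : (0 : ℝ) < n := by exact_mod_cast hn
  have hlog : 0 ≤ Real.log n := Real.log_natCast_nonneg n
  set r := √(2 * (x + Real.log n)) with hr
  have hr0 : 0 ≤ r := Real.sqrt_nonneg _
  -- The choice of `r` gives each mode an equal share of the failure probability.
  have hr2 : Real.exp (-(r ^ 2 / 2)) = Real.exp (-x) / n := by
    rw [hr, Real.sq_sqrt (by positivity), mul_div_cancel_left₀ _ two_ne_zero, neg_add,
      Real.exp_add, Real.exp_neg (Real.log n), Real.exp_log hn0, div_eq_mul_inv]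
  set c := √(((T.parts.card : ℝ) + 1) *
    Real.log (Real.exp 1 * n / ((T.parts.card : ℝ) + 1))) + r with hc
  have hc0 : 0 ≤ c := by positivity
  set B : Fin n → Set Ω := fun m => {ω | ∃ w : EuclideanSpace ℝ (Fin n),
    (fun i => w i) ∈ unimodalCone T m ∧ σ * c * ‖w‖ < inner ℝ (ξ ω) w} with hB
  have hbad : P (⋃ m, B m) ≤ ENNReal.ofReal (Real.exp (-x)) := by
    calc P (⋃ m, B m) ≤ ∑ m, P (B m) := measure_iUnion_fintype_le _ _
      _ ≤ ∑ _m : Fin n, ENNReal.ofReal (Real.exp (-x) / n) := by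
        refine Finset.sum_le_sum fun m _ => ?_
        rw [← hr2]
        exact measure_exists_unimodalCone_lt_inner_le hσ hξ T hT m hr0
      _ = ENNReal.ofReal (Real.exp (-x)) := by
        rw [Finset.sum_const, Finset.card_univ, Fintype.card_fin, nsmul_eq_mul,
          ← ENNReal.ofReal_natCast, ← ENNReal.ofReal_mul (by positivity)]
        congr 1
        field_simp
  have hgood : (⋃ m, B m)ᶜ ⊆ {ω | ∀ v ∈ leastSquares (unimodal n) (μ + ξ ω), ∀ u ∈ unimodal n,
      (∀ A ∈ T.parts, ∀ a ∈ A, ∀ b ∈ A, u a = u b) →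
      scaledNorm (v - μ) ≤ scaledNorm (u - μ) + 2 * σ / √n * c} := by
    intro ω hω v hv u hu huT
    obtain ⟨m, hm⟩ := mem_iUnion.1 hv.1
    have hz : inner ℝ (ξ ω) (v - u) ≤ σ * c * ‖v - u‖ := by
      by_contra hlt
      exact hω (mem_iUnion.2 ⟨m, v - u, sub_mem_unimodalCone T m hm huT, not_le.1 hlt⟩)
    refine (scaledNorm_sub_le_of_mem_leastSquares hn (by positivity) hu hv hz).trans_eq ?_
    ring
  refine le_trans ?_ (measure_mono hgood)
  rw [ENNReal.ofReal_sub _ (Real.exp_pos _).le, ENNReal.ofReal_one, tsub_le_iff_left]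
  calc (1 : ℝ≥0∞) = P univ := measure_univ.symm
    _ ≤ P (⋃ m, B m) + P (⋃ m, B m)ᶜ := measure_univ_le_add_compl _
    _ ≤ _ := by gcongr

/-- An infimum is approached along one of the finitely many values of an invariant. -/
theorem exists_forall_exists_lt_ciInf_add {α β : Type*} [Nonempty α] [Finite β] (F : α → ℝ)
    (τ : α → β) :
    ∃ b, ∀ ε > 0, ∃ a, τ a = b ∧ F a < (⨅ a, F a) + ε := by
  -- Otherwise each value would stay above the infimum by its own gap, and the smallest of finitely
  -- many gaps is positive.
  by_contra! h
  choose ε hε h using h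
  obtain ⟨a₀⟩ := ‹Nonempty α›
  have : Nonempty β := ⟨τ a₀⟩
  have : Nonempty α := ⟨a₀⟩
  obtain ⟨b, hb⟩ := Finite.exists_min ε
  obtain ⟨a, ha⟩ := exists_lt_of_ciInf_lt (lt_add_of_pos_right (⨅ a, F a) (hε b))
  have := h (τ a) a rfl
  have := hb (τ a)
  linarith

theorem mainTheorem8 (n : ℕ) (hn : 1 ≤ n) (σ : ℝ) (hσ : 0 < σ)
    (μ : EuclideanSpace ℝ (Fin n))
    {Ω : Type*} [MeasurableSpace Ω] (P : MeasureTheory.Measure Ω)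
    [MeasureTheory.IsProbabilityMeasure P]
    (ξ : Ω → EuclideanSpace ℝ (Fin n))
    (hξ : ProbabilityTheory.HasLaw ξ
      (ProbabilityTheory.multivariateGaussian 0 (σ ^ 2 • (1 : Matrix (Fin n) (Fin n) ℝ))) P)
    (x : ℝ) (hx : 0 < x) :
    ENNReal.ofReal (1 - Real.exp (-x)) ≤
      P {ω | ∀ v ∈ leastSquares (unimodal n) (μ + ξ ω),
        scaledNorm (v - μ) ≤
          ⨅ u : unimodal n,
            (scaledNorm ((u : EuclideanSpace ℝ (Fin n)) - μ) +
              2 * σ / √(n : ℝ) *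
                (√(((numPieces (u : EuclideanSpace ℝ (Fin n)) : ℝ) + 1) *
                    Real.log (Real.exp 1 * n /
                      ((numPieces (u : EuclideanSpace ℝ (Fin n)) : ℝ) + 1))) +
                  √(2 * (x + Real.log n))))} := by
  choose T hTcard hT using fun u : unimodal n =>
    isPiecewiseConstant_numPieces (u : EuclideanSpace ℝ (Fin n))
  have : Nonempty (unimodal n) :=
    ⟨0, mem_iUnion.2 ⟨⟨0, hn⟩, fun _ _ _ _ _ => le_rfl, fun _ _ _ _ _ => le_rfl⟩⟩
  set F : unimodal n → ℝ := fun u => scaledNorm ((u : EuclideanSpace ℝ (Fin n)) - μ) +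
    2 * σ / √(n : ℝ) *
      (√(((numPieces (u : EuclideanSpace ℝ (Fin n)) : ℝ) + 1) *
          Real.log (Real.exp 1 * n / ((numPieces (u : EuclideanSpace ℝ (Fin n)) : ℝ) + 1))) +
        √(2 * (x + Real.log n))) with hFdef
  -- `T₀` is chosen before the noise is seen, so one event serves the whole infimum. The vector `u₀`
  -- below only certifies that the parts of `T₀` are intervals.
  obtain ⟨T₀, hT₀⟩ := exists_forall_exists_lt_ciInf_add F T
  obtain ⟨u₀, hu₀, -⟩ := hT₀ 1 one_pos
  refine (measure_oracle_inequality_of_finpartition hn hσ μ hξ hx T₀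
    fun A hA => (hT u₀ A (hu₀ ▸ hA)).1).trans (measure_mono fun ω hω v hv => ?_)
  refine le_of_forall_pos_le_add fun ε hε => ?_
  obtain ⟨u, hu, hlt⟩ := hT₀ ε hε
  refine le_trans ?_ hlt.le
  have h := hω v hv u u.2 fun A hA => (hT u A (hu ▸ hA)).2
  rw [← hu, hTcard] at h
  exact h
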